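/- Fix an integer $p\ge 3$, $\beta\ge 0$ and $h\in\mathbb R$. For $N\ge 1$ let $X=(X_1,\dots,X_N)\in\{-1,1\}^N$ be distributed according to the $p$-tensor Curie–Weiss model $$\mathbb P_{\beta,h,p}(X)=\frac{1}{2^N Z_N(\beta,h,p)}\exp\Big\{\frac{\beta}{N^{p-1}}\sum_{1\le i_1,\dots,i_p\le N}X_{i_1}\cdots X_{i_p}+h\sum_{i=1}^N X_i\Big\},$$ where $Z_N(\beta,h,p)$ is the normalizing constant, and let $\overline X_N=\frac1N\sum_{i=1}^N X_i$. For $x\in[-1,1]$ put $$H(x)=\beta x^p+hx-\tfrac12\{(1+x)\log(1+x)+(1-x)\log(1-x)\},\qquad 0\log 0:=0.$$ A maximizer of $H$ means a global maximizer of $H$ on $[-1,1]$. The point $(\beta,h)$ is called $p$-regular if $H$ has a unique maximizer $m_*$, with $m_*\in(-1,1)$ and $H''(m_*)<0$; $p$-special if $H$ has a unique maximizer $m_*$, with $m_*\in(-1,1)$ and $H''(m_*)=0$; and $p$-critical if $H$ has more than one maximizer. Then, as $N\to\infty$, the following hold. (1) If $(\beta,h)$ is $p$-regular, then $N^{1/2}(\overline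 X_N-m_*)\xrightarrow{D}N\big(0,-1/H''(m_*)\big)$. (2) If $(\beta,h)$ is $p$-critical, then $H$ has exactly $K\in\{2,3\}$ maximizers $m_1<\dots<m_K$; they all lie in $(-1,1)$ and satisfy $H''(m_k)<0$; and $$\overline X_N\xrightarrow{D}\sum_{k=1}^K p_k\,\delta_{m_k},\qquad p_k=\frac{[(m_k^2-1)H''(m_k)]^{-1/2}}{\sum_{i=1}^K[(m_i^2-1)H''(m_i)]^{-1/2}}.$$ Moreover, if $1\le k\le K$ and $A\subseteq[-1,1]$ is an interval containing $m_k$ in its interior such that $H(m_k)>H(x)$ for all $x$ in the closure of $A$ other than $m_k$, then $\mathbb P_{\beta,h,p}(\overline X_N\in A)>0$ for all large $N$, and the conditional law of $N^{1/2}(\overline X_N-m_k)$ given $\{\overline X_N\in A\}$ converges weakly to $N\big(0,-1/H''(m_k)\big)$. (3) If $(\beta,h)$ is $p$-special, then $H^{(4)}(m_*)<0$ and $N^{1/4}(\overline X_N-m_*)\xrightarrow{D}F$, where $F$ is the probability distribution on $\mathbb R$ with Lebesgue density $$\frac{2}{\Gamma(1/4)}\Big(-\frac{H^{(4)}(m_*)}{24}\Big)^{1/4}\exp\Big(\frac{H^{(4)}(m_*)}{24}x^4\Big).$$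 -/

import Mathlib

open MeasureTheory ProbabilityTheory Filter Topology

noncomputable section

namespace TensorCurieWeiss

/-- The configuration space `{-1, 1}^N`, with `{-1, 1}` realized as the units of `ℤ`. -/
abbrev Config (N : ℕ) : Type := Fin N → ℤˣ

instance : MeasurableSingletonClass ℤˣ :=
  ⟨fun u => ⟨{(u : ℤ)}, measurableSet_singleton _, by ext v; simp [Units.ext_iff]⟩⟩

/-- The `i`-th spin of a configuration, as a real number. -/
def spin {N : ℕ} (x : Config N) (i : Fin N) : ℝ := ((x i : ℤ) : ℝ)

/-- The sample mean (magnetization) `(1/N) ∑ i, x_i`. -/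
def sampleMean {N : ℕ} (x : Config N) : ℝ := (1 / (N : ℝ)) * ∑ i, spin x i

/-- The unnormalized Gibbs weight
`exp (β / N^(p-1) * ∑_{i_1, …, i_p} x_{i_1} ⋯ x_{i_p} + h * ∑ i, x_i)`;
the first sum runs over all `p`-tuples of indices. -/
def weight (p : ℕ) (β h : ℝ) {N : ℕ} (x : Config N) : ℝ :=
  Real.exp (β / (N : ℝ) ^ (p - 1) * (∑ i : Fin p → Fin N, ∏ j, spin x (i j))
    + h * ∑ i, spin x i)

/-- The partition function `Z_N(β, h, p)`. -/
def partitionFn (p : ℕ) (β h : ℝ) (N : ℕ) : ℝ :=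
  1 / (2 : ℝ) ^ N * ∑ x : Config N, weight p β h x

/-- The probability of a configuration in the `p`-tensor Curie-Weiss model. -/
def prob (p : ℕ) (β h : ℝ) {N : ℕ} (x : Config N) : ℝ :=
  weight p β h x / ((2 : ℝ) ^ N * partitionFn p β h N)

theorem sum_ofReal_prob (p : ℕ) (β h : ℝ) (N : ℕ) :
    ∑ x : Config N, ENNReal.ofReal (prob p β h x) = 1 := by
  have hw : ∀ x : Config N, 0 < weight p β h x := fun x => Real.exp_pos _
  have hS : 0 < ∑ x : Config N, weight p β h x :=
    Finset.sum_pos (fun x _ => hw x) Finset.univ_nonempty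
  have hZ : (2 : ℝ) ^ N * partitionFn p β h N = ∑ x : Config N, weight p β h x := by
    unfold partitionFn
    field_simp
  have hp : ∀ x : Config N, 0 ≤ prob p β h x := fun x => by
    unfold prob
    rw [hZ]
    exact div_nonneg (hw x).le hS.le
  rw [← ENNReal.ofReal_sum_of_nonneg (fun x _ => hp x)]
  unfold prob
  rw [hZ, ← Finset.sum_div, div_self hS.ne', ENNReal.ofReal_one]

/-- The `p`-tensor Curie-Weiss model `ℙ_{β,h,p}` on `{-1, 1}^N`. -/
def model (p : ℕ) (β h : ℝ) (N : ℕ) : Measure (Config N) :=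
  (PMF.ofFintype (fun x : Config N => ENNReal.ofReal (prob p β h x))
    (sum_ofReal_prob p β h N)).toMeasure

instance (p : ℕ) (β h : ℝ) (N : ℕ) : IsProbabilityMeasure (model p β h N) :=
  PMF.toMeasure.isProbabilityMeasure _

/-- The binary entropy function `I` on `[-1, 1]` (with `0 log 0 = 0`). -/
def entropyFn (x : ℝ) : ℝ :=
  1 / 2 * ((1 + x) * Real.log (1 + x) + (1 - x) * Real.log (1 - x))

/-- The function `H_{β,h,p}`; it is meant on `[-1, 1]`, and its derivatives are only taken at
points of `(-1, 1)`. -/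
def H (p : ℕ) (β h x : ℝ) : ℝ := β * x ^ p + h * x - entropyFn x

/-- The set of global maximizers of `H_{β,h,p}` on `[-1, 1]`. -/
def maximizers (p : ℕ) (β h : ℝ) : Set ℝ :=
  {m | m ∈ Set.Icc (-1 : ℝ) 1 ∧ ∀ x ∈ Set.Icc (-1 : ℝ) 1, H p β h x ≤ H p β h m}

/-- `(β, h)` is `p`-regular. -/
def IsRegular (p : ℕ) (β h : ℝ) : Prop :=
  ∃ m ∈ Set.Ioo (-1 : ℝ) 1, maximizers p β h = {m} ∧ iteratedDeriv 2 (H p β h) m < 0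

/-- `(β, h)` is `p`-special. -/
def IsSpecial (p : ℕ) (β h : ℝ) : Prop :=
  ∃ m ∈ Set.Ioo (-1 : ℝ) 1, maximizers p β h = {m} ∧ iteratedDeriv 2 (H p β h) m = 0

/-- `(β, h)` is `p`-critical: there is more than one global maximizer. -/
def IsCritical (p : ℕ) (β h : ℝ) : Prop := (maximizers p β h).Nontrivial

/-- The centred Gaussian law `N(0, -1/H''(m))`; used only where `H''(m) < 0`. -/
def gaussianLimit (p : ℕ) (β h m : ℝ) : ProbabilityMeasure ℝ :=
  ⟨gaussianReal 0 (Real.toNNReal (-1 / iteratedDeriv 2 (H p β h) m)), inferInstance⟩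

/-- The unnormalized weight `[(m² - 1) H''(m)]^(-1/2)` of a maximizer. -/
def mixWeight (p : ℕ) (β h m : ℝ) : ℝ :=
  ((m ^ 2 - 1) * iteratedDeriv 2 (H p β h) m) ^ (-(1 / 2) : ℝ)

/-- The density of the limit law at special points. -/
def quarticDensity (p : ℕ) (β h m x : ℝ) : ℝ :=
  2 / Real.Gamma (1 / 4) * (-iteratedDeriv 4 (H p β h) m / 24) ^ (1 / 4 : ℝ)
    * Real.exp (iteratedDeriv 4 (H p β h) m / 24 * x ^ 4)

end TensorCurieWeiss

end

/-!
The sum over `p`-tuples of spins is the `p`-th power of the total spin, so the Gibbs weight depends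
on a configuration through its mean only, and the mean takes the value `x = 2 k / N - 1` with
probability proportional to `C(N, k) * exp (N * (β x ^ p + h x))`. By Stirling's formula this is
`exp (N * H x)` up to a factor of order `N ^ (-1/2)`, asymptotically proportional to
`(1 - x ^ 2) ^ (-1/2)` (`sqrt_mul_binomialRatio`). Everything then follows from Laplace's
method for these sums (`tendsto_gibbsSum`): if `m` is the strict maximizer of `H` on a set and
`H x - H m ≈ -c (x - m) ^ q` near `m`, then in the variable `t = N ^ (1/q) * (x - m)` the sum over
that set is the integral of a step function converging to a multiple of `exp (-c t ^ q)`; a Gaussian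
dominates it near `m`, and away from `m` the terms are exponentially small, since the
binomial factor never exceeds one (`binomialRatio_le_one`). The case `q = 2` gives the
Gaussian limits, `q = 4` the quartic law, and adding the contributions of several maximizers gives
the mixture, whose weights are the Laplace constants (`laplace_const_eq_mixWeight`).

What remains is the calculus of `H`. The zeros of `H''` are the solutions of
`β p (p - 1) x ^ (p - 2) * (1 - x ^ 2) = 1`, and for `x ≥ 0` the left side increases up to
`x ^ 2 = (p - 2) / p` and decreases afterwards. Four maximizers would enclose too many zeros of
`H''` for this shape (`not_four_maximizers`). At a maximizer with `H'' = 0` also `H''' = 0`, which places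
it at the peak, up to sign; then `H''` has at most one other zero, its mirror image, so by
Rolle's theorem the maximizer is unique (`eq_of_derivH2_eq_zero`), and `H'''' < 0` there
(`derivH4_neg`).
-/

namespace TensorCurieWeiss

/-! ### Derivatives of `H` -/

/-- Closed form of `H'` on `(-1, 1)`. -/
noncomputable def derivH1 (p : ℕ) (β h x : ℝ) : ℝ :=
  β * p * x ^ (p - 1) + h - (Real.log (1 + x) - Real.log (1 - x)) / 2

/-- Closed form of `H''` on `(-1, 1)`. It does not depend on `h`. -/
noncomputable def derivH2 (p : ℕ) (β x : ℝ) : ℝ :=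
  β * p * (p - 1) * x ^ (p - 2) - 1 / (1 - x ^ 2)

/-- Closed form of `H'''` on `(-1, 1)`. -/
noncomputable def derivH3 (p : ℕ) (β x : ℝ) : ℝ :=
  β * p * (p - 1) * (p - 2) * x ^ (p - 3) - 2 * x / (1 - x ^ 2) ^ 2

/-- Closed form of `H''''` on `(-1, 1)`. For `p = 3` the first term vanishes because of the
factor `p - 3`, whatever the truncated exponent `p - 4`. -/
noncomputable def derivH4 (p : ℕ) (β x : ℝ) : ℝ :=
  β * p * (p - 1) * (p - 2) * (p - 3) * x ^ (p - 4) - (2 + 6 * x ^ 2) / (1 - x ^ 2) ^ 3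

theorem one_sub_sq_pos {x : ℝ} (hx : x ∈ Set.Ioo (-1 : ℝ) 1) : 0 < 1 - x ^ 2 := by
  nlinarith [hx.1, hx.2]

theorem hasDerivAt_H (p : ℕ) (β h : ℝ) {x : ℝ} (hx : x ∈ Set.Ioo (-1 : ℝ) 1) :
    HasDerivAt (H p β h) (derivH1 p β h x) x := by
  have h1 : (1 + x) ≠ 0 := by linarith [hx.1]
  have h2 : (1 - x) ≠ 0 := by linarith [hx.2]
  have e1 : HasDerivAt (fun y : ℝ => 1 + y) 1 x := (hasDerivAt_id x).const_add 1
  have e2 : HasDerivAt (fun y : ℝ => 1 - y) (-1) x := (hasDerivAt_id x).const_sub 1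
  have := (((hasDerivAt_pow p x).const_mul β).add ((hasDerivAt_id x).const_mul h)).sub
    (((e1.mul (e1.log h1)).add (e2.mul (e2.log h2))).const_mul (1 / 2))
  refine this.congr_deriv ?_
  unfold derivH1
  field_simp
  ring

theorem hasDerivAt_derivH1 (p : ℕ) (hp : 3 ≤ p) (β h : ℝ) {x : ℝ} (hx : x ∈ Set.Ioo (-1 : ℝ) 1) :
    HasDerivAt (derivH1 p β h) (derivH2 p β x) x := by
  have h1 : (1 + x) ≠ 0 := by linarith [hx.1]
  have h2 : (1 - x) ≠ 0 := by linarith [hx.2]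
  have h3 : (1 - x ^ 2) ≠ 0 := (one_sub_sq_pos hx).ne'
  obtain ⟨n, rfl⟩ := Nat.exists_eq_add_of_le' hp
  have e1 : HasDerivAt (fun y : ℝ => 1 + y) 1 x := (hasDerivAt_id x).const_add 1
  have e2 : HasDerivAt (fun y : ℝ => 1 - y) (-1) x := (hasDerivAt_id x).const_sub 1
  have := (((hasDerivAt_pow (n + 2) x).const_mul (β * ((n + 3 : ℕ) : ℝ))).add_const h).sub
    (((e1.log h1).sub (e2.log h2)).div_const 2)
  refine this.congr_deriv ?_
  simp only [derivH2, Nat.reduceSubDiff, Nat.add_succ_sub_one]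
  push_cast
  rw [show (1 : ℝ) - x ^ 2 = (1 + x) * (1 - x) by ring]
  field_simp
  ring

theorem hasDerivAt_derivH2 (p : ℕ) (hp : 3 ≤ p) (β : ℝ) {x : ℝ} (hx : x ∈ Set.Ioo (-1 : ℝ) 1) :
    HasDerivAt (derivH2 p β) (derivH3 p β x) x := by
  have h3 : (1 - x ^ 2) ≠ 0 := (one_sub_sq_pos hx).ne'
  obtain ⟨n, rfl⟩ := Nat.exists_eq_add_of_le' hp
  have e1 : HasDerivAt (fun y : ℝ => 1 - y ^ 2) (-(((2 : ℕ) : ℝ) * x ^ 1)) x :=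
    (hasDerivAt_pow 2 x).const_sub 1
  have := ((hasDerivAt_pow (n + 1) x).const_mul
    (β * ((n + 3 : ℕ) : ℝ) * (((n + 3 : ℕ) : ℝ) - 1))).sub ((hasDerivAt_const x (1 : ℝ)).div e1 h3)
  refine this.congr_deriv ?_
  simp only [derivH3, Nat.add_sub_cancel]
  push_cast
  field_simp
  ring

theorem hasDerivAt_derivH3 (p : ℕ) (hp : 3 ≤ p) (β : ℝ) {x : ℝ} (hx : x ∈ Set.Ioo (-1 : ℝ) 1) :
    HasDerivAt (derivH3 p β) (derivH4 p β x) x := by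
  have h3 : (1 - x ^ 2) ≠ 0 := (one_sub_sq_pos hx).ne'
  obtain ⟨n, rfl⟩ := Nat.exists_eq_add_of_le' hp
  have e1 : HasDerivAt (fun y : ℝ => (1 - y ^ 2) ^ 2)
      (((2 : ℕ) : ℝ) * (1 - x ^ 2) ^ 1 * -(((2 : ℕ) : ℝ) * x ^ 1)) x :=
    ((hasDerivAt_pow 2 x).const_sub 1).pow 2
  have := ((hasDerivAt_pow n x).const_mul
    (β * ((n + 3 : ℕ) : ℝ) * (((n + 3 : ℕ) : ℝ) - 1) * (((n + 3 : ℕ) : ℝ) - 2))).sub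
      (((hasDerivAt_id x).const_mul 2).div e1 (pow_ne_zero 2 h3))
  refine this.congr_deriv ?_
  have hn : n + 3 - 4 = n - 1 := by omega
  simp only [derivH4, hn, id]
  push_cast
  field_simp
  ring

/-- If `f` has derivative `g` on an open set, then the iterated derivatives of `f` are those
of `g` with the order shifted. -/
theorem eqOn_iteratedDeriv_succ {f g g' : ℝ → ℝ} {s : Set ℝ} (hs : IsOpen s) {n : ℕ}
    (hf : Set.EqOn (iteratedDeriv n f) g s) (hg : ∀ x ∈ s, HasDerivAt g (g' x) x) :
    Set.EqOn (iteratedDeriv (n + 1) f) g' s := by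
  intro x hx
  rw [iteratedDeriv_succ, (hf.eventuallyEq_of_mem (hs.mem_nhds hx)).deriv_eq]
  exact (hg x hx).deriv

theorem iteratedDeriv_one_H (p : ℕ) (β h : ℝ) :
    Set.EqOn (iteratedDeriv 1 (H p β h)) (derivH1 p β h) (Set.Ioo (-1) 1) :=
  eqOn_iteratedDeriv_succ isOpen_Ioo (n := 0) (g := H p β h) (fun x _ => by simp)
    fun _ hx => hasDerivAt_H p β h hx

theorem iteratedDeriv_two_H (p : ℕ) (hp : 3 ≤ p) (β h : ℝ) :
    Set.EqOn (iteratedDeriv 2 (H p β h)) (derivH2 p β) (Set.Ioo (-1) 1) :=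
  eqOn_iteratedDeriv_succ isOpen_Ioo (iteratedDeriv_one_H p β h)
    fun _ hx => hasDerivAt_derivH1 p hp β h hx

theorem iteratedDeriv_three_H (p : ℕ) (hp : 3 ≤ p) (β h : ℝ) :
    Set.EqOn (iteratedDeriv 3 (H p β h)) (derivH3 p β) (Set.Ioo (-1) 1) :=
  eqOn_iteratedDeriv_succ isOpen_Ioo (iteratedDeriv_two_H p hp β h)
    fun _ hx => hasDerivAt_derivH2 p hp β hx

theorem iteratedDeriv_four_H (p : ℕ) (hp : 3 ≤ p) (β h : ℝ) :
    Set.EqOn (iteratedDeriv 4 (H p β h)) (derivH4 p β) (Set.Ioo (-1) 1) :=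
  eqOn_iteratedDeriv_succ isOpen_Ioo (iteratedDeriv_three_H p hp β h)
    fun _ hx => hasDerivAt_derivH3 p hp β hx

theorem contDiffOn_H (p : ℕ) (β h : ℝ) (n : ℕ) :
    ContDiffOn ℝ n (H p β h) (Set.Ioo (-1) 1) := by
  intro x hx
  have h1 : (1 + x) ≠ 0 := by linarith [hx.1]
  have h2 : (1 - x) ≠ 0 := by linarith [hx.2]
  apply ContDiffAt.contDiffWithinAt
  unfold H entropyFn
  have e1 : ContDiffAt ℝ n (fun y : ℝ => 1 + y) x := by fun_prop
  have e2 : ContDiffAt ℝ n (fun y : ℝ => 1 - y) x := by fun_prop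
  have l1 := e1.log h1
  have l2 := e2.log h2
  fun_prop

theorem continuous_H (p : ℕ) (β h : ℝ) : Continuous (H p β h) := by
  have l1 : Continuous fun x : ℝ => (1 + x) * Real.log (1 + x) :=
    Real.continuous_mul_log.comp (by fun_prop : Continuous fun x : ℝ => 1 + x)
  have l2 : Continuous fun x : ℝ => (1 - x) * Real.log (1 - x) :=
    Real.continuous_mul_log.comp (by fun_prop : Continuous fun x : ℝ => 1 - x)
  unfold H entropyFn
  fun_prop

/-- Taylor's theorem at a point where all derivatives of order strictly between `0` and `n`
vanish. -/
theorem tendsto_div_pow_of_iteratedDeriv_eq_zero {f : ℝ → ℝ} {a b m : ℝ} {n : ℕ} (hn : n ≠ 0)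
    (hm : m ∈ Set.Ioo a b) (hf : ContDiffOn ℝ n f (Set.Ioo a b))
    (h0 : ∀ k ∈ Finset.Ioo 0 n, iteratedDeriv k f m = 0) :
    Tendsto (fun x => (f x - f m) / (x - m) ^ n) (𝓝[≠] m)
      (𝓝 (iteratedDeriv n f m / n.factorial)) := by
  have hT := Real.taylor_tendsto (convex_Ioo a b) hm hf
  rw [nhdsWithin_eq_nhds.2 (isOpen_Ioo.mem_nhds hm)] at hT
  have hT' := (hT.mono_left nhdsWithin_le_nhds : Tendsto _ (𝓝[≠] m) _).add_const
    (iteratedDeriv n f m / n.factorial)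
  rw [zero_add] at hT'
  refine hT'.congr' ?_
  filter_upwards [self_mem_nhdsWithin] with x hx
  have hx' : (x - m) ^ n ≠ 0 := pow_ne_zero _ (sub_ne_zero.2 hx)
  obtain ⟨k, rfl⟩ := Nat.exists_eq_succ_of_ne_zero hn
  have he : taylorWithinEval f (k + 1) (Set.Ioo a b) m x =
      f m + (x - m) ^ (k + 1) * (iteratedDeriv (k + 1) f m / (k + 1).factorial) := by
    rw [taylor_within_apply, Finset.sum_range_succ, Finset.sum_range_succ', Finset.sum_eq_zero]
    · rw [iteratedDerivWithin_of_isOpen isOpen_Ioo hm, iteratedDerivWithin_of_isOpen isOpen_Ioo hm]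
      simp only [zero_add, Nat.factorial_zero, Nat.cast_one, inv_one, pow_zero, one_mul,
        iteratedDeriv_zero, smul_eq_mul]
      field_simp
    · intro i hi
      rw [iteratedDerivWithin_of_isOpen isOpen_Ioo hm, h0 _ (by simpa using hi), smul_zero]
  simp only [Nat.succ_eq_add_one] at hx' ⊢
  rw [he]
  field_simp
  ring

/-! ### Location of the maximizers -/

theorem derivH1_eq_zero {p : ℕ} {β h m : ℝ} (hm : m ∈ maximizers p β h)
    (hI : m ∈ Set.Ioo (-1 : ℝ) 1) : derivH1 p β h m = 0 := by
  have hl : IsLocalMax (H p β h) m := by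
    filter_upwards [isOpen_Ioo.mem_nhds hI] with x hx
    exact hm.2 x (Set.Ioo_subset_Icc_self hx)
  exact hl.hasDerivAt_eq_zero (hasDerivAt_H p β h hI)

/-- The right endpoint is not a maximizer, since `H' → -∞` there. -/
theorem one_notMem_maximizers (p : ℕ) (β h : ℝ) : (1 : ℝ) ∉ maximizers p β h := by
  intro hm
  have hlog : Tendsto (fun x : ℝ => Real.log (1 - x)) (𝓝[<] 1) atBot := by
    refine Real.tendsto_log_nhdsGT_zero.comp ?_
    refine tendsto_nhdsWithin_iff.2 ⟨?_, ?_⟩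
    · have : Tendsto (fun x : ℝ => 1 - x) (𝓝 1) (𝓝 (1 - 1)) := by
        apply Continuous.tendsto; fun_prop
      rw [sub_self] at this
      exact this.mono_left nhdsWithin_le_nhds
    · filter_upwards [self_mem_nhdsWithin] with x hx
      simpa using hx
  have hc : Tendsto (fun x : ℝ => β * p * x ^ (p - 1) + h - Real.log (1 + x) / 2) (𝓝[<] 1)
      (𝓝 (β * p * 1 ^ (p - 1) + h - Real.log (1 + 1) / 2)) := by
    apply Tendsto.mono_left _ nhdsWithin_le_nhds
    apply ContinuousAt.tendsto
    have : ContinuousAt (fun x : ℝ => Real.log (1 + x)) 1 :=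
      ContinuousAt.log (by fun_prop) (by norm_num)
    fun_prop
  have hd : Tendsto (derivH1 p β h) (𝓝[<] 1) atBot := by
    refine (hc.add_atBot (hlog.atBot_div_const (by norm_num : (0 : ℝ) < 2))).congr fun x => ?_
    unfold derivH1; ring
  have hev := (hd.eventually (eventually_lt_atBot 0)).and
    (Ioo_mem_nhdsLT (show (-1 : ℝ) < 1 by norm_num))
  obtain ⟨l, hl, hl'⟩ := (mem_nhdsLT_iff_exists_Ioo_subset).1 hev
  have hl1 : l < 1 := hl
  have hanti : StrictAntiOn (H p β h) (Set.Icc ((l + 1) / 2) 1) := by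
    refine strictAntiOn_of_deriv_neg (convex_Icc _ _) (continuous_H p β h).continuousOn ?_
    intro x hx
    rw [interior_Icc] at hx
    have hx' := hl' ⟨by linarith [hx.1], hx.2⟩
    rw [(hasDerivAt_H p β h hx'.2).deriv]
    exact hx'.1
  have h1 := hanti (Set.left_mem_Icc.2 (by linarith)) (Set.right_mem_Icc.2 (by linarith))
    (by linarith)
  have hlow : -1 < (l + 1) / 2 := by
    by_contra hcon
    have := (hl' (show (-1 : ℝ) ∈ Set.Ioo l 1 from ⟨by linarith, by norm_num⟩)).2.1
    exact lt_irrefl _ this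
  exact absurd (hm.2 ((l + 1) / 2) ⟨hlow.le, by linarith⟩) (not_le.2 h1)

theorem H_neg (p : ℕ) (β h x : ℝ) : H p β h (-x) = H p ((-1) ^ p * β) (-h) x := by
  unfold H entropyFn
  rw [neg_pow x p]
  ring_nf

theorem maximizers_subset_Ioo (p : ℕ) (β h : ℝ) : maximizers p β h ⊆ Set.Ioo (-1) 1 := by
  intro m hm
  refine ⟨lt_of_le_of_ne hm.1.1 ?_, lt_of_le_of_ne hm.1.2 ?_⟩
  · rintro rfl
    refine one_notMem_maximizers p ((-1) ^ p * β) (-h) ⟨by norm_num, fun x hx => ?_⟩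
    rw [← H_neg, ← H_neg]
    exact hm.2 (-x) ⟨by linarith [hx.2], by linarith [hx.1]⟩
  · rintro rfl
    exact one_notMem_maximizers p β h hm

theorem derivH2_nonpos {p : ℕ} (hp : 3 ≤ p) {β h m : ℝ} (hm : m ∈ maximizers p β h) :
    derivH2 p β m ≤ 0 := by
  have hI := maximizers_subset_Ioo p β h hm
  have hT := tendsto_div_pow_of_iteratedDeriv_eq_zero (n := 2) two_ne_zero hI
    (contDiffOn_H p β h 2) (by
      intro k hk
      obtain rfl : k = 1 := by simp at hk; omega
      rw [iteratedDeriv_one_H p β h hI, derivH1_eq_zero hm hI])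
  rw [iteratedDeriv_two_H p hp β h hI] at hT
  have : derivH2 p β m / (Nat.factorial 2 : ℕ) ≤ 0 := by
    refine le_of_tendsto hT ?_
    filter_upwards [mem_nhdsWithin_of_mem_nhds (isOpen_Ioo.mem_nhds hI)] with x hx
    exact div_nonpos_of_nonpos_of_nonneg
      (sub_nonpos.2 (hm.2 x (Set.Ioo_subset_Icc_self hx))) (sq_nonneg _)
  simp at this
  linarith

/-- At a maximizer with vanishing second derivative the third derivative vanishes too. -/
theorem derivH3_eq_zero {p : ℕ} (hp : 3 ≤ p) {β h m : ℝ} (hm : m ∈ maximizers p β h)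
    (h2 : derivH2 p β m = 0) : derivH3 p β m = 0 := by
  have hI := maximizers_subset_Ioo p β h hm
  have hT := tendsto_div_pow_of_iteratedDeriv_eq_zero (n := 3) three_ne_zero hI
    (contDiffOn_H p β h 3) (by
      intro k hk
      obtain rfl | rfl : k = 1 ∨ k = 2 := by simp at hk; omega
      · rw [iteratedDeriv_one_H p β h hI, derivH1_eq_zero hm hI]
      · rw [iteratedDeriv_two_H p hp β h hI, h2])
  rw [iteratedDeriv_three_H p hp β h hI] at hT
  -- the difference quotient of odd order changes sign at the maximizer
  have hle : derivH3 p β m / (Nat.factorial 3 : ℕ) ≤ 0 := by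
    refine le_of_tendsto (hT.mono_left (nhdsGT_le_nhdsNE m)) ?_
    filter_upwards [mem_nhdsWithin_of_mem_nhds (isOpen_Ioo.mem_nhds hI), self_mem_nhdsWithin]
      with x hx hx'
    exact div_nonpos_of_nonpos_of_nonneg
      (sub_nonpos.2 (hm.2 x (Set.Ioo_subset_Icc_self hx)))
      (pow_nonneg (sub_nonneg.2 (le_of_lt hx')) _)
  have hge : 0 ≤ derivH3 p β m / (Nat.factorial 3 : ℕ) := by
    refine ge_of_tendsto (hT.mono_left (nhdsLT_le_nhdsNE m)) ?_
    filter_upwards [mem_nhdsWithin_of_mem_nhds (isOpen_Ioo.mem_nhds hI), self_mem_nhdsWithin]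
      with x hx hx'
    exact div_nonneg_of_nonpos (sub_nonpos.2 (hm.2 x (Set.Ioo_subset_Icc_self hx)))
      (Odd.pow_nonpos (by decide) (sub_nonpos.2 (le_of_lt hx')))
  have hz := le_antisymm hle hge
  rcases div_eq_zero_iff.1 hz with hz | hz
  · exact hz
  · norm_num [Nat.factorial] at hz

/-! ### Number of maximizers -/

/-- The function `x ↦ x ^ (n + 1) * (1 - x ^ 2)`, which carries the sign of `H''`, increases
on `[0, 1]` up to its peak, where `x ^ 2 = (n + 1) / (n + 3)`. -/
theorem strictMonoOn_pow_mul (n : ℕ) {s : ℝ} (hs : (n + 3) * s ^ 2 ≤ n + 1) :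
    StrictMonoOn (fun x : ℝ => x ^ (n + 1) * (1 - x ^ 2)) (Set.Icc 0 s) := by
  refine strictMonoOn_of_deriv_pos (convex_Icc _ _) (by fun_prop) fun x hx => ?_
  rw [interior_Icc] at hx
  have hd : HasDerivAt (fun x : ℝ => x ^ (n + 1) * (1 - x ^ 2))
      (x ^ n * ((n + 1) - (n + 3) * x ^ 2)) x := by
    refine ((hasDerivAt_pow (n + 1) x).mul ((hasDerivAt_pow 2 x).const_sub 1)).congr_deriv ?_
    simp only [Nat.add_sub_cancel]
    push_cast
    ring
  rw [hd.deriv]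
  have : x ^ 2 < s ^ 2 := pow_lt_pow_left₀ hx.2 hx.1.le two_ne_zero
  have hn : (0 : ℝ) < n + 3 := by positivity
  exact mul_pos (pow_pos hx.1 n) (by nlinarith)

theorem strictAntiOn_pow_mul (n : ℕ) {s : ℝ} (h0 : 0 < s) (hs : n + 1 ≤ (n + 3) * s ^ 2) :
    StrictAntiOn (fun x : ℝ => x ^ (n + 1) * (1 - x ^ 2)) (Set.Icc s 1) := by
  refine strictAntiOn_of_deriv_neg (convex_Icc _ _) (by fun_prop) fun x hx => ?_
  rw [interior_Icc] at hx
  have hd : HasDerivAt (fun x : ℝ => x ^ (n + 1) * (1 - x ^ 2))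
      (x ^ n * ((n + 1) - (n + 3) * x ^ 2)) x := by
    refine ((hasDerivAt_pow (n + 1) x).mul ((hasDerivAt_pow 2 x).const_sub 1)).congr_deriv ?_
    simp only [Nat.add_sub_cancel]
    push_cast
    ring
  rw [hd.deriv]
  have : s ^ 2 < x ^ 2 := pow_lt_pow_left₀ hx.1 h0.le two_ne_zero
  have hn : (0 : ℝ) < n + 3 := by positivity
  exact mul_neg_of_pos_of_neg (pow_pos (h0.trans hx.1) n) (by nlinarith)

/-- `H''` vanishes exactly where the unimodal function takes a given value. -/
theorem derivH2_eq_zero_iff {n : ℕ} {β x : ℝ} (hx : x ∈ Set.Ioo (-1 : ℝ) 1) :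
    derivH2 (n + 3) β x = 0 ↔ β * (n + 3) * (n + 2) * (x ^ (n + 1) * (1 - x ^ 2)) = 1 := by
  have h3 := one_sub_sq_pos hx
  simp only [derivH2, Nat.reduceSubDiff, sub_eq_zero, eq_div_iff h3.ne']
  push_cast
  constructor <;> intro h <;> linear_combination h

theorem derivH2_neg_iff {n : ℕ} {β x : ℝ} (hx : x ∈ Set.Ioo (-1 : ℝ) 1) :
    derivH2 (n + 3) β x < 0 ↔ β * (n + 3) * (n + 2) * (x ^ (n + 1) * (1 - x ^ 2)) < 1 := by
  have h3 := one_sub_sq_pos hx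
  simp only [derivH2, Nat.reduceSubDiff, sub_neg, lt_div_iff₀ h3]
  push_cast
  rw [show β * (n + 3) * (n + 2) * (x ^ (n + 1) * (1 - x ^ 2)) =
    β * (n + 3) * (n + 3 - 1) * x ^ (n + 1) * (1 - x ^ 2) by ring]

/-- Since `β ≥ 0`, zeros of `H''` may be reflected to the positive half-line. -/
theorem abs_of_derivH2_eq_zero {n : ℕ} {β x : ℝ} (hβ : 0 ≤ β) (hx : x ∈ Set.Ioo (-1 : ℝ) 1)
    (h : derivH2 (n + 3) β x = 0) :
    0 < β ∧ 0 < |x| ∧ β * (n + 3) * (n + 2) * (|x| ^ (n + 1) * (1 - |x| ^ 2)) = 1 := by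
  rw [derivH2_eq_zero_iff hx] at h
  have h3 := one_sub_sq_pos hx
  refine ⟨hβ.lt_of_ne ?_, abs_pos.2 ?_, ?_⟩
  · rintro rfl; simp at h
  · rintro rfl; simp at h
  · have := congrArg abs h
    rw [abs_mul, abs_one, abs_mul (x ^ (n + 1)), abs_pow, abs_of_pos h3,
      abs_of_nonneg (by positivity : 0 ≤ β * (n + 3) * (n + 2))] at this
    rw [sq_abs, this]

/-- Between two zeros of `H''` in the positive half-line, `H''` is positive. -/
theorem not_derivH2_neg_of_between {n : ℕ} {β x y z : ℝ} (hβ : 0 ≤ β) (hx0 : 0 ≤ x) (hz1 : z < 1)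
    (hxy : x < y) (hyz : y < z) (hx : derivH2 (n + 3) β x = 0) (hz : derivH2 (n + 3) β z = 0) :
    ¬ derivH2 (n + 3) β y < 0 := by
  have hβ' := (abs_of_derivH2_eq_zero hβ ⟨by linarith, by linarith⟩ hx).1
  rw [derivH2_eq_zero_iff ⟨by linarith, by linarith⟩] at hx hz
  rw [derivH2_neg_iff ⟨by linarith, by linarith⟩, not_lt]
  have hc : 0 ≤ β * (n + 3) * (n + 2) := by positivity
  rcases le_total ((n + 3) * y ^ 2) ((n : ℝ) + 1) with hy | hy
  · refine hx.symm.trans_le ?_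
    exact mul_le_mul_of_nonneg_left (strictMonoOn_pow_mul n hy ⟨hx0, hxy.le⟩
      ⟨hx0.trans hxy.le, le_rfl⟩ hxy).le hc
  · refine hz.symm.trans_le ?_
    exact mul_le_mul_of_nonneg_left (strictAntiOn_pow_mul n (hx0.trans_lt hxy) hy
      ⟨le_rfl, (hyz.trans hz1).le⟩ ⟨hyz.le, hz1.le⟩ hyz).le hc

/-- Two consecutive zeros of `H'` enclose a zero of `H''`. -/
theorem exists_derivH2_eq_zero {p : ℕ} (hp : 3 ≤ p) {β h a b : ℝ} (ha : -1 < a) (hb : b < 1)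
    (hab : a < b) (ha0 : derivH1 p β h a = 0) (hb0 : derivH1 p β h b = 0) :
    ∃ c ∈ Set.Ioo a b, derivH2 p β c = 0 :=
  exists_hasDerivAt_eq_zero hab
    (fun _ hx => (hasDerivAt_derivH1 p hp β h ⟨by linarith [hx.1], by linarith [hx.2]⟩
      ).continuousAt.continuousWithinAt) (ha0.trans hb0.symm)
    fun _ hx => hasDerivAt_derivH1 p hp β h ⟨by linarith [hx.1], by linarith [hx.2]⟩

theorem sq_of_derivH2_derivH3 {n : ℕ} {β m : ℝ} (hm : m ∈ Set.Ioo (-1 : ℝ) 1)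
    (h2 : derivH2 (n + 3) β m = 0) (h3 : derivH3 (n + 3) β m = 0) :
    (n + 3) * m ^ 2 = n + 1 := by
  have hpos := one_sub_sq_pos hm
  rw [derivH2_eq_zero_iff hm] at h2
  simp only [derivH3, Nat.add_sub_cancel] at h3
  push_cast at h3
  rw [sub_eq_zero, eq_div_iff (by positivity)] at h3
  have h4 : (n + 1) * (1 - m ^ 2) = 2 * m ^ 2 := by
    linear_combination m * h3 - (n + 1) * (1 - m ^ 2) * h2
  linarith

/-- A point where `H''` and `H'''` vanish is, in absolute value, the peak of the unimodal
function, so `H''` has no other zeros up to sign. -/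
theorem eq_or_eq_neg_of_derivH2_eq_zero {n : ℕ} {β m x : ℝ} (hβ : 0 ≤ β)
    (hm : m ∈ Set.Ioo (-1 : ℝ) 1) (hx : x ∈ Set.Ioo (-1 : ℝ) 1)
    (h2 : derivH2 (n + 3) β m = 0) (h3 : derivH3 (n + 3) β m = 0)
    (hx2 : derivH2 (n + 3) β x = 0) : x = m ∨ x = -m := by
  have hs := sq_of_derivH2_derivH3 hm h2 h3
  rw [← sq_abs] at hs
  obtain ⟨hβ', hm0, hm1⟩ := abs_of_derivH2_eq_zero hβ hm h2
  obtain ⟨-, hx0, hx1⟩ := abs_of_derivH2_eq_zero hβ hx hx2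
  have hc : β * (n + 3) * (n + 2) ≠ 0 := by positivity
  have he := mul_left_cancel₀ hc (hm1.trans hx1.symm)
  have hxl : |x| < 1 := abs_lt.2 hx
  have hml : |m| < 1 := abs_lt.2 hm
  refine abs_eq_abs.1 ?_
  rcases le_total |x| |m| with hle | hle
  · exact ((strictMonoOn_pow_mul n hs.le).injOn ⟨hm0.le, le_rfl⟩ ⟨hx0.le, hle⟩ he).symm
  · exact ((strictAntiOn_pow_mul n hm0 hs.ge).injOn ⟨le_rfl, hml.le⟩ ⟨hle, hxl.le⟩ he).symm

/-- A maximizer with vanishing second derivative is the only maximizer. -/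
theorem eq_of_derivH2_eq_zero {p : ℕ} (hp : 3 ≤ p) {β h m m' : ℝ} (hβ : 0 ≤ β)
    (hm : m ∈ maximizers p β h) (hm' : m' ∈ maximizers p β h) (h2 : derivH2 p β m = 0) :
    m' = m := by
  have h3 := derivH3_eq_zero hp hm h2
  have hI := maximizers_subset_Ioo p β h hm
  have hI' := maximizers_subset_Ioo p β h hm'
  have hd := derivH1_eq_zero hm hI
  have hd' := derivH1_eq_zero hm' hI'
  have hH : H p β h m = H p β h m' := le_antisymm (hm'.2 _ hm.1) (hm.2 _ hm'.1)
  obtain ⟨n, rfl⟩ := Nat.exists_eq_add_of_le' hp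
  -- two zeros of `H''` strictly between `a` and `b`
  have key : ∀ a b : ℝ, -1 < a → b < 1 → a < b → H (n + 3) β h a = H (n + 3) β h b →
      derivH1 (n + 3) β h a = 0 → derivH1 (n + 3) β h b = 0 →
      ∃ x y, a < x ∧ x < y ∧ y < b ∧ derivH2 (n + 3) β x = 0 ∧ derivH2 (n + 3) β y = 0 := by
    intro a b ha hb hab hHab h1a h1b
    obtain ⟨c, hc, hc0⟩ := exists_hasDerivAt_eq_zero hab (continuous_H _ β h).continuousOn hHab
      fun x hx => hasDerivAt_H (n + 3) β h ⟨by linarith [hx.1], by linarith [hx.2]⟩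
    obtain ⟨x, hx, hx0⟩ := exists_derivH2_eq_zero hp ha (hc.2.trans hb) hc.1 h1a hc0
    obtain ⟨y, hy, hy0⟩ := exists_derivH2_eq_zero hp (ha.trans hc.1) hb hc.2 hc0 h1b
    exact ⟨x, y, hx.1, hx.2.trans hy.1, hy.2, hx0, hy0⟩
  by_contra hne
  rcases lt_or_gt_of_ne hne with hlt | hlt
  · obtain ⟨x, y, hx, hxy, hy, hx0, hy0⟩ := key m' m hI'.1 hI.2 hlt hH.symm hd' hd
    have h1 := eq_or_eq_neg_of_derivH2_eq_zero hβ hI ⟨by linarith [hI'.1], by linarith [hI.2]⟩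
      h2 h3 hx0
    have h2 := eq_or_eq_neg_of_derivH2_eq_zero hβ hI ⟨by linarith [hI'.1], by linarith [hI.2]⟩
      h2 h3 hy0
    grind
  · obtain ⟨x, y, hx, hxy, hy, hx0, hy0⟩ := key m m' hI.1 hI'.2 hlt hH hd hd'
    have h1 := eq_or_eq_neg_of_derivH2_eq_zero hβ hI ⟨by linarith [hI.1], by linarith [hI'.2]⟩
      h2 h3 hx0
    have h2 := eq_or_eq_neg_of_derivH2_eq_zero hβ hI ⟨by linarith [hI.1], by linarith [hI'.2]⟩
      h2 h3 hy0
    grind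

theorem derivH2_neg_of_isCritical {p : ℕ} (hp : 3 ≤ p) {β h m : ℝ} (hβ : 0 ≤ β)
    (hc : IsCritical p β h) (hm : m ∈ maximizers p β h) : derivH2 p β m < 0 := by
  refine (derivH2_nonpos hp hm).lt_of_ne fun h0 => ?_
  obtain ⟨m', hm', hne⟩ := hc.exists_ne m
  exact hne (eq_of_derivH2_eq_zero hp hβ hm hm' h0)

theorem derivH4_neg {p : ℕ} (hp : 3 ≤ p) {β m : ℝ} (hm : m ∈ Set.Ioo (-1 : ℝ) 1)
    (h2 : derivH2 p β m = 0) (h3 : derivH3 p β m = 0) : derivH4 p β m < 0 := by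
  obtain ⟨n, rfl⟩ := Nat.exists_eq_add_of_le' hp
  have hs := sq_of_derivH2_derivH3 hm h2 h3
  have hpos := one_sub_sq_pos hm
  rw [derivH2_eq_zero_iff hm] at h2
  have hn : (0 : ℝ) ≤ n := n.cast_nonneg
  have hm2 : 0 < m ^ 2 := by
    by_contra hcon
    have : m ^ 2 = 0 := le_antisymm (not_lt.1 hcon) (sq_nonneg m)
    rw [this] at hs; linarith
  have he : n + 3 - 4 = n - 1 := by omega
  have e1 : (n : ℝ) * (m ^ (n - 1) * m ^ 2) = n * m ^ (n + 1) := by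
    rcases n with _ | k
    · simp
    · simp only [Nat.add_sub_cancel]; ring
  have hm' : m ^ 2 = (n + 1) / (n + 3) := by
    rw [eq_div_iff (by positivity)]; linarith
  -- the product `m² (1 - m²) H''''(m)` turns out to equal `-(n + 1) (n + 3)`
  have e2 : derivH4 (n + 3) β m * (m ^ 2 * (1 - m ^ 2)) =
      (n + 1) * n - (2 + 6 * m ^ 2) * m ^ 2 / (1 - m ^ 2) ^ 2 := by
    simp only [derivH4, he]
    push_cast
    have e3 : β * (n + 3) * (n + 3 - 1) * (n + 3 - 2) * (n + 3 - 3) * m ^ (n - 1)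
        * (m ^ 2 * (1 - m ^ 2)) = (n + 1) * n := by
      linear_combination (β * (n + 3) * (n + 2) * (n + 1) * (1 - m ^ 2)) * e1
        + (n + 1) * n * h2
    rw [sub_mul, e3]
    field_simp
  have e4 : (n + 1) * n - (2 + 6 * m ^ 2) * m ^ 2 / (1 - m ^ 2) ^ 2 = -(n + 1) * (n + 3) := by
    have : 1 - m ^ 2 = 2 / (n + 3) := by rw [hm']; field_simp; ring
    rw [this, hm']
    field_simp
    ring
  have e5 : derivH4 (n + 3) β m * (m ^ 2 * (1 - m ^ 2)) < 0 := by
    rw [e2, e4]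
    have : 0 < ((n : ℝ) + 1) * (n + 3) := by positivity
    linarith
  by_contra hcon
  exact absurd e5 (not_lt.2 (mul_nonneg (not_lt.1 hcon) (by positivity)))

/-- There cannot be four maximizers: they would enclose three zeros of `H''`, two of them of the
same sign with a maximizer in between. -/
theorem not_four_maximizers {p : ℕ} (hp : 3 ≤ p) {β h : ℝ} (hβ : 0 ≤ β) (m : Fin 4 → ℝ)
    (hmono : StrictMono m) (hm : ∀ i, m i ∈ maximizers p β h) : False := by
  have hI i := maximizers_subset_Ioo p β h (hm i)
  have hd i := derivH1_eq_zero (hm i) (hI i)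
  have h01 : m 0 < m 1 := hmono (by decide)
  have h12 : m 1 < m 2 := hmono (by decide)
  have h23 : m 2 < m 3 := hmono (by decide)
  have hcr : IsCritical p β h := ⟨m 0, hm 0, m 1, hm 1, h01.ne⟩
  have hneg i := derivH2_neg_of_isCritical hp hβ hcr (hm i)
  obtain ⟨a, ha, ha0⟩ := exists_derivH2_eq_zero hp (hI 0).1 (hI 1).2 h01 (hd 0) (hd 1)
  obtain ⟨b, hb, hb0⟩ := exists_derivH2_eq_zero hp (hI 1).1 (hI 2).2 h12 (hd 1) (hd 2)
  obtain ⟨c, hc, hc0⟩ := exists_derivH2_eq_zero hp (hI 2).1 (hI 3).2 h23 (hd 2) (hd 3)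
  obtain ⟨n, rfl⟩ := Nat.exists_eq_add_of_le' hp
  rcases le_or_gt 0 b with hb' | hb'
  · exact not_derivH2_neg_of_between hβ hb' (hc.2.trans (hI 3).2) hb.2 hc.1 hb0 hc0 (hneg 2)
  · have haI : a ∈ Set.Ioo (-1 : ℝ) 1 := ⟨by linarith [(hI 0).1, ha.1], by linarith [(hI 1).2, ha.2]⟩
    have hbI : b ∈ Set.Ioo (-1 : ℝ) 1 := ⟨by linarith [(hI 1).1, hb.1], by linarith⟩
    rcases Nat.even_or_odd (n + 1) with he | ho
    · have hsymm : ∀ x, derivH2 (n + 3) β (-x) = derivH2 (n + 3) β x := fun x => by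
        simp only [derivH2, Nat.reduceSubDiff, he.neg_pow, neg_sq]
      refine not_derivH2_neg_of_between (n := n) (x := -b) (y := -m 1) (z := -a) hβ (by linarith)
        (by linarith [haI.1]) (by linarith [hb.1]) (by linarith [ha.2]) ?_ ?_ ?_
      · rw [hsymm, hb0]
      · rw [hsymm, ha0]
      · rw [hsymm]; exact hneg 1
    · -- for odd `p` the derivative `H''` is negative on the negative half-line
      rw [derivH2_eq_zero_iff hbI] at hb0
      have h1 : b ^ (n + 1) < 0 := ho.pow_neg hb'
      have h2 := one_sub_sq_pos hbI
      have h3 : 0 ≤ β * (n + 3) * (n + 2) := by positivity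
      nlinarith [mul_nonneg h3 (mul_nonneg (neg_nonneg.2 h1.le) h2.le)]

/-- At a critical point the maximizers form an increasing family of length two or three. -/
theorem exists_enum_maximizers {p : ℕ} (hp : 3 ≤ p) {β h : ℝ} (hβ : 0 ≤ β)
    (hc : IsCritical p β h) :
    ∃ (K : ℕ) (m : Fin K → ℝ), (K = 2 ∨ K = 3) ∧ StrictMono m ∧
      Set.range m = maximizers p β h := by
  have hno : ∀ s : Finset ℝ, (s : Set ℝ) ⊆ maximizers p β h → s.card ≠ 4 := fun s hs h4 =>
    not_four_maximizers hp hβ (s.orderEmbOfFin h4) (s.orderEmbOfFin h4).strictMono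
      fun i => hs (s.orderEmbOfFin_mem h4 i)
  have hfin : (maximizers p β h).Finite := by
    by_contra hinf
    obtain ⟨t, ht, h4⟩ := Set.Infinite.exists_subset_card_eq hinf 4
    exact hno t ht h4
  lift maximizers p β h to Finset ℝ using hfin with s hs
  have hs4 : s.card < 4 := by
    by_contra hcon
    obtain ⟨t, ht, h4⟩ := Finset.exists_subset_card_eq (not_lt.1 hcon)
    exact hno t (by exact_mod_cast ht) h4
  have hs2 : 1 < s.card := by
    rw [Finset.one_lt_card_iff_nontrivial, ← Finset.nontrivial_coe, hs]
    exact hc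
  exact ⟨s.card, s.orderEmbOfFin rfl, by omega, (s.orderEmbOfFin rfl).strictMono, by simp⟩

/-! ### The law of the magnetization -/

/-- The value of the sample mean when `k` of the `N` spins are `+1`. -/
noncomputable def gridPoint (N k : ℕ) : ℝ := 2 * k / N - 1

/-- The mass `C(N, k) / 2 ^ N` that fair coins give to `gridPoint N k`, divided by its exponential
order `exp (-N I)`, where `I` is the binary entropy. -/
noncomputable def binomialRatio (N k : ℕ) : ℝ :=
  N.choose k / 2 ^ N * Real.exp (N * entropyFn (gridPoint N k))

/-- The unnormalized Gibbs average of `φ` of the sample mean, in units of `exp (N * H m)`. -/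
noncomputable def gibbsSum (p : ℕ) (β h m : ℝ) (N : ℕ) (φ : ℝ → ℝ) : ℝ :=
  ∑ k ∈ Finset.range (N + 1), binomialRatio N k
    * Real.exp (N * (H p β h (gridPoint N k) - H p β h m)) * φ (gridPoint N k)

theorem weight_eq {p : ℕ} (hp : p ≠ 0) (β h : ℝ) {N : ℕ} (hN : N ≠ 0) (x : Config N) :
    weight p β h x = Real.exp (N * (β * sampleMean x ^ p + h * sampleMean x)) := by
  obtain ⟨n, rfl⟩ := Nat.exists_eq_succ_of_ne_zero hp
  have hN' : (N : ℝ) ≠ 0 := Nat.cast_ne_zero.2 hN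
  unfold weight sampleMean
  rw [← Fintype.sum_pow]
  congr 1
  simp only [Nat.succ_eq_add_one, Nat.add_sub_cancel, mul_pow, div_pow]
  field_simp
  ring

/-- Configurations are grouped according to their number of `+1` spins. -/
theorem sum_config (N : ℕ) (hN : N ≠ 0) (F : ℝ → ℝ) :
    ∑ x : Config N, F (sampleMean x) =
      ∑ k ∈ Finset.range (N + 1), N.choose k * F (gridPoint N k) := by
  classical
  have hN' : (N : ℝ) ≠ 0 := Nat.cast_ne_zero.2 hN
  have h1 := Finset.sum_powerset_apply_card (x := (Finset.univ : Finset (Fin N)))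
    (fun k => F (gridPoint N k))
  simp only [Finset.card_univ, Fintype.card_fin, nsmul_eq_mul, Finset.powerset_univ] at h1
  rw [← h1]
  refine Finset.sum_bij' (fun x _ => Finset.univ.filter fun i => x i = 1)
    (fun s _ i => if i ∈ s then 1 else -1) (by simp) (by simp) ?_ ?_ ?_
  · intro x _
    funext i
    rcases Int.units_eq_one_or (x i) with h | h <;> simp [h]
  · intro s _
    ext i
    by_cases h : i ∈ s
    · simp [h]
    · simp [h]
  · intro x _
    congr 1
    have hs : ∀ i, spin x i = 2 * (if x i = 1 then 1 else 0) - 1 := by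
      intro i
      unfold spin
      rcases Int.units_eq_one_or (x i) with h | h
      · rw [h]; norm_num
      · have : ¬ ((-1 : ℤˣ) = 1) := by decide
        rw [h, if_neg this]; norm_num
    unfold sampleMean gridPoint
    simp only [hs, Finset.sum_sub_distrib, ← Finset.mul_sum, Finset.sum_boole, Finset.sum_const,
      Finset.card_univ, Fintype.card_fin, nsmul_eq_mul, mul_one]
    field_simp

theorem sum_weight_mul {p : ℕ} (hp : p ≠ 0) (β h m : ℝ) {N : ℕ} (hN : N ≠ 0) (φ : ℝ → ℝ) :
    ∑ x : Config N, weight p β h x * φ (sampleMean x) =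
      2 ^ N * Real.exp (N * H p β h m) * gibbsSum p β h m N φ := by
  simp_rw [weight_eq hp β h hN]
  rw [sum_config N hN fun y => Real.exp (N * (β * y ^ p + h * y)) * φ y, gibbsSum, Finset.mul_sum]
  refine Finset.sum_congr rfl fun k _ => ?_
  have he : Real.exp (N * (β * gridPoint N k ^ p + h * gridPoint N k)) =
      Real.exp (N * H p β h m) * (Real.exp (N * entropyFn (gridPoint N k)) *
        Real.exp (N * (H p β h (gridPoint N k) - H p β h m))) := by
    rw [← Real.exp_add, ← Real.exp_add]
    congr 1
    simp only [H]
    ring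
  rw [he, binomialRatio]
  field_simp

theorem gibbsSum_one_pos {p : ℕ} (hp : p ≠ 0) (β h m : ℝ) {N : ℕ} (hN : N ≠ 0) :
    0 < gibbsSum p β h m N fun _ => 1 := by
  have h1 := sum_weight_mul hp β h m hN fun _ => 1
  have h2 : 0 < ∑ x : Config N, weight p β h x * 1 :=
    Finset.sum_pos (fun x _ => by rw [mul_one]; exact Real.exp_pos _) Finset.univ_nonempty
  rw [h1] at h2
  exact (mul_pos_iff_of_pos_left (by positivity)).1 h2

/-- The law of the sample mean. The reference point `m` is immaterial. -/
theorem integral_model {p : ℕ} (hp : p ≠ 0) (β h m : ℝ) {N : ℕ} (hN : N ≠ 0) (φ : ℝ → ℝ) :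
    ∫ x, φ (sampleMean x) ∂(model p β h N) =
      gibbsSum p β h m N φ / gibbsSum p β h m N fun _ => 1 := by
  have hZ : (2 : ℝ) ^ N * partitionFn p β h N =
      2 ^ N * Real.exp (N * H p β h m) * gibbsSum p β h m N fun _ => 1 := by
    rw [← sum_weight_mul hp β h m hN]
    unfold partitionFn
    field_simp
  have hpos := gibbsSum_one_pos hp β h m hN
  rw [model, PMF.integral_eq_sum]
  have : ∀ x : Config N, ((PMF.ofFintype (fun x : Config N => ENNReal.ofReal (prob p β h x))
      (sum_ofReal_prob p β h N)) x).toReal = weight p β h x / (2 ^ N * partitionFn p β h N) := by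
    intro x
    rw [PMF.ofFintype_apply, ENNReal.toReal_ofReal]
    · rfl
    · unfold prob
      rw [hZ]
      exact div_nonneg (Real.exp_pos _).le (by positivity)
  simp_rw [this, smul_eq_mul, div_mul_eq_mul_div]
  rw [← Finset.sum_div, sum_weight_mul hp β h m hN, hZ, mul_div_mul_left _ _ (by positivity)]

theorem measurable_of_config {N : ℕ} {α : Type*} [MeasurableSpace α] (f : Config N → α) :
    Measurable f := measurable_of_finite f

/-- The law of the sample mean conditioned to lie in `A`. -/
theorem integral_cond_model {p : ℕ} (hp : p ≠ 0) (β h m : ℝ) {N : ℕ} (hN : N ≠ 0) (A : Set ℝ)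
    (φ : ℝ → ℝ) :
    ∫ x, φ (sampleMean x) ∂(ProbabilityTheory.cond (model p β h N) {x | sampleMean x ∈ A}) =
      gibbsSum p β h m N (A.indicator φ) / gibbsSum p β h m N (A.indicator fun _ => 1) := by
  have hA : MeasurableSet {x : Config N | sampleMean x ∈ A} :=
    Set.Finite.measurableSet (Set.toFinite _)
  have hpos := gibbsSum_one_pos hp β h m hN
  have hmass : (model p β h N).real {x | sampleMean x ∈ A} =
      gibbsSum p β h m N (A.indicator fun _ => 1) / gibbsSum p β h m N fun _ => 1 := by
    rw [← integral_model hp β h m hN, ← integral_indicator_one hA]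
    rfl
  rw [ProbabilityTheory.cond, integral_smul_measure, ← integral_indicator hA, ENNReal.toReal_inv,
    ← Measure.real,
    hmass]
  have : ∫ x, {x : Config N | sampleMean x ∈ A}.indicator (fun x => φ (sampleMean x)) x
      ∂(model p β h N) = ∫ x, A.indicator φ (sampleMean x) ∂(model p β h N) := rfl
  rw [this, integral_model hp β h m hN, smul_eq_mul, inv_div, mul_comm, div_mul_div_cancel₀ hpos.ne']

theorem model_ne_zero {p : ℕ} (hp : p ≠ 0) (β h m : ℝ) {N : ℕ} (hN : N ≠ 0) {A : Set ℝ}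
    (hA : gibbsSum p β h m N (A.indicator fun _ => 1) ≠ 0) :
    model p β h N {x | sampleMean x ∈ A} ≠ 0 := by
  intro h0
  have h1 := integral_model hp β h m hN (A.indicator fun _ => 1)
  have h2 : ∫ x, A.indicator (fun _ => (1 : ℝ)) (sampleMean x) ∂(model p β h N) =
      (model p β h N).real {x | sampleMean x ∈ A} := by
    rw [← integral_indicator_one (Set.Finite.measurableSet (Set.toFinite _))]
    rfl
  rw [h2, Measure.real, h0, ENNReal.toReal_zero, eq_comm, div_eq_zero_iff] at h1
  exact h1.elim hA (gibbsSum_one_pos hp β h m hN).ne'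

/-! ### Stirling's formula for the binomial distribution -/

theorem exp_entropyFn_gridPoint {N k : ℕ} (hN : N ≠ 0) (hk : k ≤ N) :
    Real.exp (N * entropyFn (gridPoint N k)) =
      2 ^ N * ((k / N : ℝ) ^ k * (((N - k : ℕ) : ℝ) / N) ^ (N - k)) := by
  have hN' : (N : ℝ) ≠ 0 := Nat.cast_ne_zero.2 hN
  have hexp : ∀ j : ℕ, Real.exp (j * Real.log (2 * (j / N))) = (2 * (j / N : ℝ)) ^ j := by
    intro j
    rcases Nat.eq_zero_or_pos j with rfl | hj
    · simp
    · rw [← Real.log_pow, Real.exp_log (by positivity)]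
  have h1 : 1 + gridPoint N k = 2 * (k / N) := by unfold gridPoint; ring
  have h2 : 1 - gridPoint N k = 2 * (((N - k : ℕ) : ℝ) / N) := by
    unfold gridPoint
    rw [Nat.cast_sub hk]
    field_simp
    ring
  have h3 : N * entropyFn (gridPoint N k) = k * Real.log (2 * (k / N)) +
      ((N - k : ℕ) : ℝ) * Real.log (2 * (((N - k : ℕ) : ℝ) / N)) := by
    unfold entropyFn
    rw [h1, h2]
    field_simp
  rw [h3, Real.exp_add, hexp, hexp, mul_pow, mul_pow]
  have : (2 : ℝ) ^ N = 2 ^ k * 2 ^ (N - k) := by rw [← pow_add, Nat.add_sub_cancel' hk]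
  rw [this]
  ring

theorem binomialRatio_nonneg (N k : ℕ) : 0 ≤ binomialRatio N k := by
  unfold binomialRatio; positivity

theorem binomialRatio_eq {N k : ℕ} (hN : N ≠ 0) (hk : k ≤ N) :
    binomialRatio N k = (k / N : ℝ) ^ k * (((N - k : ℕ) : ℝ) / N) ^ (N - k) * N.choose k := by
  rw [binomialRatio, exp_entropyFn_gridPoint hN hk]
  field_simp

/-- The ratio is a single binomial probability with parameter `k / N`. -/
theorem binomialRatio_le_one {N k : ℕ} (hN : N ≠ 0) (hk : k ≤ N) : binomialRatio N k ≤ 1 := by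
  have hN' : (N : ℝ) ≠ 0 := Nat.cast_ne_zero.2 hN
  rw [binomialRatio_eq hN hk]
  have h1 := add_pow (k / N : ℝ) (((N - k : ℕ) : ℝ) / N) N
  have h2 : (k / N : ℝ) + ((N - k : ℕ) : ℝ) / N = 1 := by
    rw [Nat.cast_sub hk]; field_simp; ring
  rw [h2, one_pow] at h1
  rw [h1]
  exact Finset.single_le_sum
    (f := fun j => (k / N : ℝ) ^ j * (((N - k : ℕ) : ℝ) / N) ^ (N - j) * N.choose j)
    (fun j _ => by positivity) (Finset.mem_range.2 (Nat.lt_succ_of_le hk))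

theorem factorial_eq_stirlingSeq_mul {n : ℕ} (hn : n ≠ 0) :
    (n.factorial : ℝ) = Stirling.stirlingSeq n * (√(2 * n) * (n / Real.exp 1) ^ n) := by
  have : (0 : ℝ) < n := by positivity
  rw [Stirling.stirlingSeq, div_mul_cancel₀]
  positivity

theorem sqrt_mul_binomialRatio {N k : ℕ} (hk0 : 0 < k) (hkN : k < N) :
    √N * binomialRatio N k = Stirling.stirlingSeq N
      / (Stirling.stirlingSeq k * Stirling.stirlingSeq (N - k))
      * √(2 / (1 - gridPoint N k ^ 2)) := by
  obtain ⟨l, rfl⟩ := Nat.exists_eq_add_of_le hkN.le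
  have hl0 : 0 < l := by omega
  have hkl : k + l - k = l := by omega
  have hk' : (0 : ℝ) < k := by positivity
  have hl' : (0 : ℝ) < l := by positivity
  rw [binomialRatio_eq (by omega) hkN.le, hkl, Nat.cast_add_choose,
    factorial_eq_stirlingSeq_mul (show k + l ≠ 0 by omega), factorial_eq_stirlingSeq_mul hk0.ne',
    factorial_eq_stirlingSeq_mul hl0.ne']
  have hs : ∀ n : ℕ, 0 < n → 0 < Stirling.stirlingSeq n := fun n hn => by
    obtain ⟨j, rfl⟩ := Nat.exists_eq_succ_of_ne_zero hn.ne'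
    exact Stirling.stirlingSeq'_pos j
  have hsk := hs k hk0
  have hsl := hs l hl0
  have hr : √(2 / (1 - gridPoint (k + l) k ^ 2)) =
      √((k + l : ℕ) : ℝ) * √(2 * ((k + l : ℕ) : ℝ)) / (√(2 * k) * √(2 * l)) := by
    rw [← Real.sqrt_mul (by positivity), ← Real.sqrt_mul (by positivity),
      ← Real.sqrt_div (by positivity)]
    congr 1
    have : 1 - gridPoint (k + l) k ^ 2 = 4 * k * l / (k + l) ^ 2 := by
      unfold gridPoint
      push_cast
      field_simp
      ring
    rw [this]
    push_cast
    field_simp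
    ring
  rw [hr]
  have h1 : 0 < √(2 * (k : ℝ)) := by positivity
  have h2 : 0 < √(2 * (l : ℝ)) := by positivity
  push_cast
  simp only [div_pow, pow_add]
  field_simp

/-! ### Sums as integrals of step functions -/

theorem indicator_natFloor_eq_sum (g : ℕ → ℝ) (n : ℕ) (s : ℝ) :
    (Set.Ico (0 : ℝ) n).indicator (fun s => g ⌊s⌋₊) s =
      ∑ k ∈ Finset.range n, (Set.Ico (k : ℝ) (k + 1)).indicator (fun _ => g k) s := by
  by_cases hs : s ∈ Set.Ico (0 : ℝ) n
  · rw [Set.indicator_of_mem hs, Finset.sum_eq_single ⌊s⌋₊]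
    · rw [Set.indicator_of_mem]
      exact ⟨Nat.floor_le hs.1, Nat.lt_floor_add_one s⟩
    · intro k _ hk
      refine Set.indicator_of_notMem (fun hks => hk ?_) _
      exact ((Nat.floor_eq_iff hs.1).2 hks).symm
    · intro hn
      exact absurd (Finset.mem_range.2 ((Nat.floor_lt hs.1).2 hs.2)) hn
  · rw [Set.indicator_of_notMem hs, Finset.sum_eq_zero]
    intro k hk
    refine Set.indicator_of_notMem (fun hks => hs ⟨k.cast_nonneg.trans hks.1, hks.2.trans_le ?_⟩) _
    exact_mod_cast Finset.mem_range.1 hk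

theorem measurable_indicator_natFloor (g : ℕ → ℝ) (n : ℕ) :
    Measurable ((Set.Ico (0 : ℝ) n).indicator fun s => g ⌊s⌋₊) :=
  ((measurable_from_nat (f := g)).comp Nat.measurable_floor).indicator measurableSet_Ico

theorem sum_range_eq_integral (g : ℕ → ℝ) (n : ℕ) :
    ∑ k ∈ Finset.range n, g k =
      ∫ s, (Set.Ico (0 : ℝ) n).indicator (fun s => g ⌊s⌋₊) s := by
  simp_rw [indicator_natFloor_eq_sum]
  rw [integral_finsetSum]
  · refine Finset.sum_congr rfl fun k _ => ?_
    rw [integral_indicator measurableSet_Ico]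
    simp
  · intro k _
    refine (integrable_indicator_iff measurableSet_Ico).2 ?_
    exact integrableOn_const (by simp)

theorem sum_range_eq_integral_affine (g : ℕ → ℝ) (n : ℕ) (c : ℝ) {b : ℝ} (hb : 0 < b) :
    ∑ k ∈ Finset.range n, g k =
      b * ∫ t, (Set.Ico (0 : ℝ) n).indicator (fun s => g ⌊s⌋₊) (c + b * t) := by
  rw [sum_range_eq_integral,
    Measure.integral_comp_mul_left
      (fun y => (Set.Ico (0 : ℝ) n).indicator (fun s => g ⌊s⌋₊) (c + y)) b,
    integral_add_left_eq_self, abs_of_pos (inv_pos.2 hb), smul_eq_mul, mul_inv_cancel_left₀ hb.ne']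

/-! ### Laplace's method for the Gibbs sums -/

/-- In the rescaled variable `t`, rounding down to the grid moves a point by at most
`2 * N ^ (a - 1)`. -/
theorem abs_rescaled_gridPoint_sub_le {N : ℕ} (hN : N ≠ 0) (a m t : ℝ)
    (hs : 0 ≤ N * (1 + m) / 2 + (N : ℝ) ^ (1 - a) / 2 * t) :
    |(N : ℝ) ^ a * (gridPoint N ⌊N * (1 + m) / 2 + (N : ℝ) ^ (1 - a) / 2 * t⌋₊ - m) - t| ≤
      2 * (N : ℝ) ^ (a - 1) := by
  set s := N * (1 + m) / 2 + (N : ℝ) ^ (1 - a) / 2 * t with hsdef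
  have hN' : (0 : ℝ) < N := by positivity
  have h1 := Nat.floor_le hs
  have h2 := Nat.lt_floor_add_one s
  have e1 : (N : ℝ) ^ (a - 1) = (N : ℝ) ^ a / N := by rw [Real.rpow_sub_one hN'.ne']
  have e2 : (N : ℝ) ^ (1 - a) = N / (N : ℝ) ^ a := by rw [Real.rpow_sub hN', Real.rpow_one]
  have hp : 0 < (N : ℝ) ^ a := by positivity
  have e3 : (N : ℝ) ^ a * (gridPoint N ⌊s⌋₊ - m) - t = 2 * (N : ℝ) ^ (a - 1) * (⌊s⌋₊ - s) := by
    rw [hsdef, e1, e2]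
    unfold gridPoint
    field_simp
    ring
  rw [e3, abs_mul, abs_of_pos (by positivity)]
  refine mul_le_of_le_one_right (by positivity) ?_
  rw [abs_le]
  constructor <;> linarith

theorem binomialRatio_bound {N k : ℕ} (hk0 : 0 < k) (hkN : k < N) :
    √N * binomialRatio N k ≤
      Stirling.stirlingSeq 1 / Real.pi * √(2 / (1 - gridPoint N k ^ 2)) := by
  rw [sqrt_mul_binomialRatio hk0 hkN]
  have hπ : 0 < √Real.pi := Real.sqrt_pos.2 Real.pi_pos
  have h1 := Stirling.sqrt_pi_le_stirlingSeq hk0.ne'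
  have h2 := Stirling.sqrt_pi_le_stirlingSeq (show N - k ≠ 0 by omega)
  have h3 : Stirling.stirlingSeq N ≤ Stirling.stirlingSeq 1 := by
    obtain ⟨j, rfl⟩ := Nat.exists_eq_succ_of_ne_zero (show N ≠ 0 by omega)
    exact Stirling.stirlingSeq'_antitone (Nat.zero_le j)
  have h4 : 0 ≤ Stirling.stirlingSeq N :=
    hπ.le.trans (Stirling.sqrt_pi_le_stirlingSeq (show N ≠ 0 by omega))
  refine mul_le_mul_of_nonneg_right ?_ (Real.sqrt_nonneg _)
  refine div_le_div₀ (h4.trans h3) h3 Real.pi_pos ?_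
  calc Real.pi = √Real.pi * √Real.pi := (Real.mul_self_sqrt Real.pi_pos.le).symm
    _ ≤ _ := mul_le_mul h1 h2 hπ.le (hπ.le.trans h1)

theorem gridPoint_mem_Icc {N k : ℕ} (hk : k ≤ N) : gridPoint N k ∈ Set.Icc (-1 : ℝ) 1 := by
  unfold gridPoint
  have h0 : (0 : ℝ) ≤ k / N := by positivity
  have h1 : (k : ℝ) / N ≤ 1 := div_le_one_of_le₀ (by exact_mod_cast hk) (by positivity)
  rw [mul_div_assoc]
  constructor <;> linarith

theorem gridPoint_eq_natCast {N k : ℕ} (hN : N ≠ 0) :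
    (k : ℝ) = N * ((1 + gridPoint N k) / 2) := by
  unfold gridPoint
  field_simp
  ring

theorem gridPoint_mem_Ioo {N k : ℕ} (hN : N ≠ 0) (hx : gridPoint N k ∈ Set.Ioo (-1 : ℝ) 1) :
    0 < k ∧ k < N := by
  have hN' : (0 : ℝ) < N := by positivity
  have h := gridPoint_eq_natCast (k := k) hN
  constructor
  · have : (0 : ℝ) < k := by rw [h]; exact mul_pos hN' (by linarith [hx.1])
    exact_mod_cast this
  · have : (k : ℝ) < N := by rw [h]; exact mul_lt_of_lt_one_right hN' (by linarith [hx.2])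
    exact_mod_cast this

theorem tendsto_natCast_rpow_atTop {a : ℝ} (ha : 0 < a) :
    Tendsto (fun N : ℕ => (N : ℝ) ^ a) atTop atTop :=
  (tendsto_rpow_atTop ha).comp tendsto_natCast_atTop_atTop

/-- A sequence that is bounded on the scale `N ^ (-a)` around `m` converges to `m`. -/
theorem tendsto_of_tendsto_rescaled {a m t : ℝ} (ha : 0 < a) {u : ℕ → ℝ}
    (hu : Tendsto (fun N : ℕ => (N : ℝ) ^ a * (u N - m)) atTop (𝓝 t)) :
    Tendsto u atTop (𝓝 m) := by
  have h1 := ((tendsto_natCast_rpow_atTop ha).inv_tendsto_atTop.mul hu).add_const m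
  rw [zero_mul, zero_add] at h1
  refine h1.congr' ?_
  filter_upwards [eventually_ne_atTop 0] with N hN
  have : (0 : ℝ) < (N : ℝ) ^ a := by positivity
  simp only [Pi.inv_apply]
  field_simp
  ring

/-- The local limit theorem: asymptotics of a single term of the Gibbs sum, on the scale
`N ^ (-a)` around `m` on which `N * (H x - H m)` stays bounded. -/
theorem tendsto_gibbs_term {p : ℕ} {β h m a c t : ℝ} {q : ℕ} (hm : m ∈ Set.Ioo (-1 : ℝ) 1)
    (ha : 0 < a) (haq : a * q = 1)
    (hT : Tendsto (fun x => (H p β h x - H p β h m) / (x - m) ^ q) (𝓝[≠] m) (𝓝 (-c)))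
    {k : ℕ → ℕ} (hk : Tendsto (fun N : ℕ => (N : ℝ) ^ a * (gridPoint N (k N) - m)) atTop (𝓝 t)) :
    Tendsto (fun N : ℕ => √N * binomialRatio N (k N)
        * Real.exp (N * (H p β h (gridPoint N (k N)) - H p β h m))) atTop
      (𝓝 (√(2 / (1 - m ^ 2)) / √Real.pi * Real.exp (-c * t ^ q))) := by
  have hq : q ≠ 0 := by rintro rfl; simp at haq
  have hx : Tendsto (fun N => gridPoint N (k N)) atTop (𝓝 m) := tendsto_of_tendsto_rescaled ha hk
  have hx2 : ∀ᶠ N in atTop, N ≠ 0 ∧ 0 < k N ∧ k N < N := by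
    filter_upwards [hx.eventually (isOpen_Ioo.mem_nhds hm), eventually_ne_atTop 0] with N h1 h2
    exact ⟨h2, gridPoint_mem_Ioo h2 h1⟩
  have hkt : Tendsto k atTop atTop := by
    rw [← tendsto_natCast_atTop_iff (R := ℝ)]
    have h1 : Tendsto (fun N => (1 + gridPoint N (k N)) / 2) atTop (𝓝 ((1 + m) / 2)) :=
      (hx.const_add 1).div_const 2
    refine (tendsto_natCast_atTop_atTop.atTop_mul_pos (by linarith [hm.1]) h1).congr' ?_
    filter_upwards [eventually_ne_atTop 0] with N hN
    exact (gridPoint_eq_natCast hN).symm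
  have hlt : Tendsto (fun N => N - k N) atTop atTop := by
    rw [← tendsto_natCast_atTop_iff (R := ℝ)]
    have h1 : Tendsto (fun N => (1 - gridPoint N (k N)) / 2) atTop (𝓝 ((1 - m) / 2)) :=
      (hx.const_sub 1).div_const 2
    refine (tendsto_natCast_atTop_atTop.atTop_mul_pos (by linarith [hm.2]) h1).congr' ?_
    filter_upwards [hx2] with N hN
    rw [Nat.cast_sub hN.2.2.le]
    have := gridPoint_eq_natCast (k := k N) hN.1
    linarith
  have hS := Stirling.tendsto_stirlingSeq_sqrt_pi
  have hπ : √Real.pi ≠ 0 := (Real.sqrt_pos.2 Real.pi_pos).ne'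
  have hratio : Tendsto (fun N : ℕ => √N * binomialRatio N (k N)) atTop
      (𝓝 (√(2 / (1 - m ^ 2)) / √Real.pi)) := by
    have h1 := hS.div ((hS.comp hkt).mul (hS.comp hlt)) (mul_ne_zero hπ hπ)
    have h2 : Tendsto (fun N => √(2 / (1 - gridPoint N (k N) ^ 2))) atTop
        (𝓝 √(2 / (1 - m ^ 2))) :=
      (tendsto_const_nhds.div ((hx.pow 2).const_sub 1) (one_sub_sq_pos hm).ne').sqrt
    have h3 := h1.mul h2
    have e : √Real.pi / (√Real.pi * √Real.pi) * √(2 / (1 - m ^ 2)) =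
        √(2 / (1 - m ^ 2)) / √Real.pi := by field_simp
    rw [e] at h3
    refine h3.congr' ?_
    filter_upwards [hx2] with N hN
    exact (sqrt_mul_binomialRatio hN.2.1 hN.2.2).symm
  -- the quotient, extended continuously to `m`
  have hφ : ContinuousAt (Function.update
      (fun x => (H p β h x - H p β h m) / (x - m) ^ q) m (-c)) m :=
    continuousAt_update_same.2 hT
  have hexp : Tendsto (fun N : ℕ => N * (H p β h (gridPoint N (k N)) - H p β h m)) atTop
      (𝓝 (-c * t ^ q)) := by
    have h1 := (hφ.tendsto.comp hx).mul (hk.pow q)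
    rw [Function.update_self] at h1
    refine h1.congr' ?_
    filter_upwards [eventually_ne_atTop 0] with N hN
    have hNq : ((N : ℝ) ^ a) ^ q = N := by
      rw [← Real.rpow_natCast, ← Real.rpow_mul (by positivity), haq, Real.rpow_one]
    simp only [Function.comp_apply, mul_pow, hNq]
    by_cases he : gridPoint N (k N) = m
    · simp [he, hq]
    · have : (gridPoint N (k N) - m) ^ q ≠ 0 := pow_ne_zero _ (sub_ne_zero.2 he)
      rw [Function.update_of_ne he]
      field_simp
  exact hratio.mul ((Real.continuous_exp.tendsto _).comp hexp)

theorem sq_sub_one_le_pow {q : ℕ} (hq : Even q) (hq0 : q ≠ 0) (u : ℝ) : u ^ 2 - 1 ≤ u ^ q := by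
  rcases le_total (u ^ 2) 1 with h | h
  · linarith [hq.pow_nonneg u]
  · obtain ⟨r, rfl⟩ := hq
    rw [← two_mul, pow_mul]
    linarith [le_self_pow₀ h (show r ≠ 0 by omega)]

theorem gibbsSum_add (p : ℕ) (β h m : ℝ) (N : ℕ) (φ ψ : ℝ → ℝ) :
    gibbsSum p β h m N (φ + ψ) = gibbsSum p β h m N φ + gibbsSum p β h m N ψ := by
  simp only [gibbsSum, Pi.add_apply, mul_add, Finset.sum_add_distrib]

/-- Points at which `H` is bounded away from `H m` do not contribute. -/
theorem tendsto_gibbsSum_far {p : ℕ} {β h m a B δ : ℝ} (ha : a ≤ 1 / 2) (hδ : 0 < δ)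
    {φ : ℕ → ℝ → ℝ} (hB : ∀ N x, |φ N x| ≤ B)
    (hφ : ∀ N : ℕ, ∀ x ∈ Set.Icc (-1 : ℝ) 1, φ N x ≠ 0 → H p β h x ≤ H p β h m - δ) :
    Tendsto (fun N : ℕ => (N : ℝ) ^ (a - 1 / 2) * gibbsSum p β h m N (φ N)) atTop (𝓝 0) := by
  have hlim : Tendsto (fun N : ℕ => B * ((N + 1) * Real.exp (-δ * N))) atTop (𝓝 0) := by
    have h1 : Tendsto (fun N : ℕ => (N : ℝ) ^ (1 : ℝ) * Real.exp (-δ * N)) atTop (𝓝 0) :=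
      (tendsto_rpow_mul_exp_neg_mul_atTop_nhds_zero 1 δ hδ).comp tendsto_natCast_atTop_atTop
    have h2 : Tendsto (fun N : ℕ => (N : ℝ) ^ (0 : ℝ) * Real.exp (-δ * N)) atTop (𝓝 0) :=
      (tendsto_rpow_mul_exp_neg_mul_atTop_nhds_zero 0 δ hδ).comp tendsto_natCast_atTop_atTop
    have h3 := (h1.add h2).const_mul B
    simp only [add_zero, mul_zero] at h3
    refine h3.congr fun N => ?_
    rw [Real.rpow_one, Real.rpow_zero]
    ring
  refine squeeze_zero_norm' ?_ hlim
  filter_upwards [eventually_ne_atTop 0] with N hN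
  have hN1 : (1 : ℝ) ≤ N := by exact_mod_cast Nat.one_le_iff_ne_zero.2 hN
  have hB0 : 0 ≤ B := (abs_nonneg _).trans (hB 0 0)
  have hp : (N : ℝ) ^ (a - 1 / 2) ≤ 1 := Real.rpow_le_one_of_one_le_of_nonpos hN1 (by linarith)
  have hterm : ∀ k ∈ Finset.range (N + 1), |binomialRatio N k
      * Real.exp (N * (H p β h (gridPoint N k) - H p β h m)) * φ N (gridPoint N k)| ≤
      B * Real.exp (-δ * N) := by
    intro k hk
    have hkN : k ≤ N := Nat.lt_succ_iff.1 (Finset.mem_range.1 hk)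
    by_cases h0 : φ N (gridPoint N k) = 0
    · rw [h0, mul_zero, abs_zero]; positivity
    · have h1 := hφ N _ (gridPoint_mem_Icc hkN) h0
      have h2 : Real.exp (N * (H p β h (gridPoint N k) - H p β h m)) ≤ Real.exp (-δ * N) := by
        apply Real.exp_le_exp.2
        nlinarith
      rw [abs_mul, abs_mul, abs_of_nonneg (binomialRatio_nonneg N k), Real.abs_exp, mul_comm B]
      refine mul_le_mul ?_ (hB _ _) (abs_nonneg _) (Real.exp_pos _).le
      calc _ ≤ 1 * Real.exp (-δ * N) :=
            mul_le_mul (binomialRatio_le_one hN hkN) h2 (Real.exp_pos _).le zero_le_one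
        _ = _ := one_mul _
  rw [Real.norm_eq_abs, abs_mul, abs_of_nonneg (by positivity : 0 ≤ (N : ℝ) ^ (a - 1 / 2))]
  calc _ ≤ 1 * |gibbsSum p β h m N (φ N)| := mul_le_mul_of_nonneg_right hp (abs_nonneg _)
    _ ≤ ∑ k ∈ Finset.range (N + 1), B * Real.exp (-δ * N) := by
      rw [one_mul]
      exact (Finset.abs_sum_le_sum_abs _ _).trans (Finset.sum_le_sum hterm)
    _ = _ := by
      rw [Finset.sum_const, Finset.card_range, nsmul_eq_mul]
      push_cast
      ring

/-- Laplace's method in a small window around `m`: the rescaled sum is the integral of a step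
function that converges pointwise and is dominated by a Gaussian. -/
theorem tendsto_gibbsSum_window {p : ℕ} {β h m a c ε B : ℝ} {q : ℕ}
    (ha : 0 < a) (ha1 : a ≤ 1 / 2) (haq : a * q = 1) (hq : Even q) (hc : 0 < c) (hε : 0 < ε)
    (hl : -1 < m - ε) (hr : m + ε < 1)
    (hT : Tendsto (fun x => (H p β h x - H p β h m) / (x - m) ^ q) (𝓝[≠] m) (𝓝 (-c)))
    (hlow : ∀ x ∈ Set.Icc (m - ε) (m + ε), H p β h x - H p β h m ≤ -(c / 2) * (x - m) ^ q)
    {f : ℕ → ℝ → ℝ} {F : ℝ → ℝ} (hB : ∀ N x, |f N x| ≤ B)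
    (hf : ∀ (t : ℝ) (u : ℕ → ℝ), Tendsto (fun N : ℕ => (N : ℝ) ^ a * (u N - m)) atTop (𝓝 t) →
      Tendsto (fun N => f N (u N)) atTop (𝓝 (F t))) :
    Tendsto (fun N : ℕ => (N : ℝ) ^ (a - 1 / 2) *
        gibbsSum p β h m N ((Set.Icc (m - ε) (m + ε)).indicator (f N))) atTop
      (𝓝 (√(2 / (1 - m ^ 2)) / √Real.pi / 2 * ∫ t, F t * Real.exp (-c * t ^ q))) := by
  have hm : m ∈ Set.Ioo (-1 : ℝ) 1 := ⟨by linarith, by linarith⟩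
  have hq0 : q ≠ 0 := by rintro rfl; simp at haq
  have hB0 : 0 ≤ B := (abs_nonneg _).trans (hB 0 0)
  set W := Set.Icc (m - ε) (m + ε) with hW
  -- the rescaled Gibbs sum is the integral of `ψ N`; `pos N t` is the index, before rounding, of
  -- the point `m + N ^ (-a) * t`
  set term : ℕ → ℕ → ℝ := fun N k => binomialRatio N k
    * Real.exp (N * (H p β h (gridPoint N k) - H p β h m)) * W.indicator (f N) (gridPoint N k)
    with hterm
  set pos : ℕ → ℝ → ℝ := fun N t => N * (1 + m) / 2 + (N : ℝ) ^ (1 - a) / 2 * t with hpos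
  set ψ : ℕ → ℝ → ℝ := fun N t => √N / 2 *
    (Set.Ico (0 : ℝ) ((N + 1 : ℕ) : ℝ)).indicator (fun s => term N ⌊s⌋₊) (pos N t) with hψ
  have hint : ∀ᶠ N : ℕ in atTop, ∫ t, ψ N t =
      (N : ℝ) ^ (a - 1 / 2) * gibbsSum p β h m N (W.indicator (f N)) := by
    filter_upwards [eventually_ne_atTop 0] with N hN
    have hN' : (0 : ℝ) < N := by positivity
    have hb : 0 < (N : ℝ) ^ (1 - a) / 2 := by positivity
    have h1 := sum_range_eq_integral_affine (term N) (N + 1) (N * (1 + m) / 2) hb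
    rw [gibbsSum, h1, integral_const_mul, ← mul_assoc]
    congr 1
    rw [mul_div_assoc', ← Real.rpow_add hN', Real.sqrt_eq_rpow]
    congr 2
    ring
  have hfloor : ∀ (N : ℕ) (t : ℝ), N ≠ 0 → 0 ≤ pos N t →
      |(N : ℝ) ^ a * (gridPoint N ⌊pos N t⌋₊ - m) - t| ≤ 2 * (N : ℝ) ^ (a - 1) :=
    fun N t hN h0 => abs_rescaled_gridPoint_sub_le hN a m t h0
  -- a lower bound for `1 - x ^ 2` on the window
  set η := (1 - (m + ε)) * (1 + (m - ε)) with hη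
  have hη0 : 0 < η := mul_pos (by linarith) (by linarith)
  have hηle : ∀ x ∈ W, η ≤ 1 - x ^ 2 := by
    intro x hx
    have := mul_le_mul (show 1 - (m + ε) ≤ 1 - x by linarith [hx.2])
      (show 1 + (m - ε) ≤ 1 + x by linarith [hx.1]) (by linarith) (by linarith [hx.2])
    calc η ≤ (1 - x) * (1 + x) := this
      _ = _ := by ring
  set D := Stirling.stirlingSeq 1 / Real.pi * √(2 / η) with hD
  have hs1 : 0 < Stirling.stirlingSeq 1 := Stirling.stirlingSeq'_pos 0
  have hD0 : 0 ≤ D := by have := Real.pi_pos; positivity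
  have hbound : ∀ᶠ N : ℕ in atTop, ∀ᵐ t, ‖ψ N t‖ ≤
      D * B / 2 * Real.exp (5 * c / 2) * Real.exp (-(c / 4) * t ^ 2) := by
    filter_upwards [eventually_ne_atTop 0] with N hN
    refine ae_of_all _ fun t => ?_
    have hN1 : (1 : ℝ) ≤ N := by exact_mod_cast Nat.one_le_iff_ne_zero.2 hN
    have hR : 0 ≤ D * B / 2 * Real.exp (5 * c / 2) * Real.exp (-(c / 4) * t ^ 2) := by positivity
    simp only [hψ]
    by_cases hmem : pos N t ∈ Set.Ico (0 : ℝ) ((N + 1 : ℕ) : ℝ)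
    swap
    · rw [Set.indicator_of_notMem hmem, mul_zero, norm_zero]; exact hR
    rw [Set.indicator_of_mem hmem]
    simp only [hterm]
    set k := ⌊pos N t⌋₊ with hk
    by_cases hx : gridPoint N k ∈ W
    swap
    · rw [Set.indicator_of_notMem hx, mul_zero, mul_zero, norm_zero]; exact hR
    rw [Set.indicator_of_mem hx]
    have hxI : gridPoint N k ∈ Set.Ioo (-1 : ℝ) 1 := ⟨by linarith [hx.1], by linarith [hx.2]⟩
    obtain ⟨hk0, hkN⟩ := gridPoint_mem_Ioo hN hxI
    have hb1 : √N * binomialRatio N k ≤ D := by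
      refine (binomialRatio_bound hk0 hkN).trans ?_
      refine mul_le_mul_of_nonneg_left (Real.sqrt_le_sqrt ?_) (by positivity)
      exact div_le_div_of_nonneg_left zero_le_two hη0 (hηle _ hx)
    set u := (N : ℝ) ^ a * (gridPoint N k - m) with hu
    have hut : |u - t| ≤ 2 := by
      refine (hfloor N t hN hmem.1).trans ?_
      have := Real.rpow_le_one_of_one_le_of_nonpos hN1 (show a - 1 ≤ 0 by linarith)
      linarith
    have hNq : ((N : ℝ) ^ a) ^ q = N := by
      rw [← Real.rpow_natCast, ← Real.rpow_mul (by positivity), haq, Real.rpow_one]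
    have hexp : N * (H p β h (gridPoint N k) - H p β h m) ≤ 5 * c / 2 + -(c / 4) * t ^ 2 := by
      have h1 : N * (H p β h (gridPoint N k) - H p β h m) ≤ -(c / 2) * u ^ q := by
        have := mul_le_mul_of_nonneg_left (hlow _ hx) (by positivity : (0 : ℝ) ≤ N)
        rw [hu, mul_pow, hNq]
        linarith
      have h2 := sq_sub_one_le_pow hq hq0 u
      have h3 : t ^ 2 / 2 - 4 ≤ u ^ 2 := by
        have := abs_le.1 hut
        have h4 : (u - t) ^ 2 ≤ 4 := by nlinarith
        nlinarith [sq_nonneg (2 * u - t)]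
      nlinarith
    have hexp' := Real.exp_le_exp.2 hexp
    rw [Real.exp_add] at hexp'
    have e1 : ‖√N / 2 * (binomialRatio N k * Real.exp (N * (H p β h (gridPoint N k) - H p β h m))
        * f N (gridPoint N k))‖ = (√N * binomialRatio N k)
        * (Real.exp (N * (H p β h (gridPoint N k) - H p β h m)) * |f N (gridPoint N k)|) / 2 := by
      rw [Real.norm_eq_abs, abs_mul, abs_mul, abs_mul, Real.abs_exp,
        abs_of_nonneg (binomialRatio_nonneg N k), abs_of_nonneg (by positivity)]
      ring
    rw [e1]
    have e2 := mul_le_mul hb1 (mul_le_mul hexp' (hB N (gridPoint N k)) (abs_nonneg _) (by positivity))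
      (by positivity) hD0
    calc _ ≤ D * (Real.exp (5 * c / 2) * Real.exp (-(c / 4) * t ^ 2) * B) / 2 :=
          div_le_div_of_nonneg_right e2 zero_le_two
      _ = _ := by ring
  have hlim : ∀ᵐ t, Tendsto (fun N => ψ N t) atTop
      (𝓝 (√(2 / (1 - m ^ 2)) / √Real.pi / 2 * (F t * Real.exp (-c * t ^ q)))) := by
    refine ae_of_all _ fun t => ?_
    have hposlim : Tendsto (fun N : ℕ => pos N t / N) atTop (𝓝 ((1 + m) / 2)) := by
      have h1 : Tendsto (fun N : ℕ => (1 + m) / 2 + ((N : ℝ) ^ a)⁻¹ * (t / 2)) atTop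
          (𝓝 ((1 + m) / 2 + 0 * (t / 2))) :=
        ((tendsto_natCast_rpow_atTop ha).inv_tendsto_atTop.mul_const _).const_add _
      rw [zero_mul, add_zero] at h1
      refine h1.congr' ?_
      filter_upwards [eventually_ne_atTop 0] with N hN
      have hN' : (0 : ℝ) < N := by positivity
      simp only [hpos, Real.rpow_sub hN', Real.rpow_one]
      have : (0 : ℝ) < (N : ℝ) ^ a := by positivity
      field_simp
    have hmem : ∀ᶠ N : ℕ in atTop, N ≠ 0 ∧ pos N t ∈ Set.Ico (0 : ℝ) ((N + 1 : ℕ) : ℝ) := by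
      filter_upwards [hposlim.eventually (isOpen_Ioo.mem_nhds
        (show (1 + m) / 2 ∈ Set.Ioo (0 : ℝ) 1 from ⟨by linarith [hm.1], by linarith [hm.2]⟩)),
        eventually_ne_atTop 0] with N h1 hN
      have hN' : (0 : ℝ) < N := by positivity
      have h2 : pos N t < N := by have := h1.2; rwa [div_lt_one hN'] at this
      refine ⟨hN, ?_, ?_⟩
      · by_contra hcon
        exact absurd h1.1 (not_lt.2 (div_nonpos_of_nonpos_of_nonneg (not_le.1 hcon).le hN'.le))
      · push_cast; linarith
    have hu : Tendsto (fun N : ℕ => (N : ℝ) ^ a * (gridPoint N ⌊pos N t⌋₊ - m)) atTop (𝓝 t) := by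
      rw [tendsto_iff_norm_sub_tendsto_zero]
      have h0 : Tendsto (fun N : ℕ => 2 * (N : ℝ) ^ (a - 1)) atTop (𝓝 0) := by
        have := (tendsto_natCast_rpow_atTop
          (show 0 < 1 - a by linarith)).inv_tendsto_atTop.const_mul 2
        rw [mul_zero] at this
        refine this.congr fun N => ?_
        rw [Pi.inv_apply, ← Real.rpow_neg (by positivity), neg_sub]
      refine squeeze_zero' (Eventually.of_forall fun _ => norm_nonneg _) ?_ h0
      filter_upwards [hmem] with N hN
      exact hfloor N t hN.1 hN.2.1
    have hx : ∀ᶠ N : ℕ in atTop, gridPoint N ⌊pos N t⌋₊ ∈ W :=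
      (tendsto_of_tendsto_rescaled ha hu).eventually (Icc_mem_nhds (by linarith) (by linarith))
    have h1 := ((tendsto_gibbs_term hm ha haq hT hu).mul (hf t _ hu)).div_const 2
    have e : √(2 / (1 - m ^ 2)) / √Real.pi * Real.exp (-c * t ^ q) * F t / 2 =
        √(2 / (1 - m ^ 2)) / √Real.pi / 2 * (F t * Real.exp (-c * t ^ q)) := by ring
    rw [e] at h1
    refine h1.congr' ?_
    filter_upwards [hmem, hx] with N hN hxN
    simp only [hψ, hterm]
    rw [Set.indicator_of_mem hN.2, Set.indicator_of_mem hxN]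
    ring
  have hdom := tendsto_integral_filter_of_dominated_convergence
    (fun t : ℝ => D * B / 2 * Real.exp (5 * c / 2) * Real.exp (-(c / 4) * t ^ 2))
    (Eventually.of_forall fun N => ?_) hbound
    ((integrable_exp_neg_mul_sq (by positivity : 0 < c / 4)).const_mul _) hlim
  · rw [integral_const_mul] at hdom
    exact hdom.congr' hint
  · refine Measurable.aestronglyMeasurable ?_
    refine Measurable.const_mul ?_ _
    refine (measurable_indicator_natFloor (term N) (N + 1)).comp ?_
    simp only [hpos]
    fun_prop

/-- On a compact set, `H` is uniformly below any strict upper bound. -/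
theorem exists_gap {p : ℕ} {β h M : ℝ} {C : Set ℝ} (hC : IsCompact C)
    (hM : ∀ x ∈ C, H p β h x < M) : ∃ δ > 0, ∀ x ∈ C, H p β h x ≤ M - δ := by
  rcases C.eq_empty_or_nonempty with rfl | hne
  · exact ⟨1, one_pos, by simp⟩
  · obtain ⟨y, hy, hmax⟩ := hC.exists_isMaxOn hne (continuous_H p β h).continuousOn
    refine ⟨M - H p β h y, sub_pos.2 (hM y hy), fun x hx => ?_⟩
    rw [sub_sub_cancel]
    exact hmax hx

/-- Laplace's method on a set `A` when `m` is the strict maximizer of `H` on the closure of `A`, with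
`H x - H m ≈ -c * (x - m) ^ q` near `m`. -/
theorem tendsto_gibbsSum {p : ℕ} {β h m a c B : ℝ} {q : ℕ} {A : Set ℝ}
    (ha : 0 < a) (ha1 : a ≤ 1 / 2) (haq : a * q = 1) (hq : Even q) (hc : 0 < c)
    (hm : m ∈ Set.Ioo (-1 : ℝ) 1) (hmA : m ∈ interior A)
    (hA : ∀ x, x ∈ (Set.Icc (-1 : ℝ) 1 ∩ closure A) \ {m} → H p β h x < H p β h m)
    (hT : Tendsto (fun x => (H p β h x - H p β h m) / (x - m) ^ q) (𝓝[≠] m) (𝓝 (-c)))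
    {f : ℕ → ℝ → ℝ} {F : ℝ → ℝ} (hB : ∀ N x, |f N x| ≤ B)
    (hf : ∀ (t : ℝ) (u : ℕ → ℝ), Tendsto (fun N : ℕ => (N : ℝ) ^ a * (u N - m)) atTop (𝓝 t) →
      Tendsto (fun N => f N (u N)) atTop (𝓝 (F t))) :
    Tendsto (fun N : ℕ => (N : ℝ) ^ (a - 1 / 2) * gibbsSum p β h m N (A.indicator (f N))) atTop
      (𝓝 (√(2 / (1 - m ^ 2)) / √Real.pi / 2 * ∫ t, F t * Real.exp (-c * t ^ q))) := by
  have hB0 : 0 ≤ B := (abs_nonneg _).trans (hB 0 0)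
  have hq0 : q ≠ 0 := by rintro rfl; simp at haq
  have hev : ∀ᶠ x in 𝓝 m, x ∈ Set.Ioo (-1 : ℝ) 1 ∧ x ∈ A ∧
      H p β h x - H p β h m ≤ -(c / 2) * (x - m) ^ q := by
    have h1 := hT.eventually (eventually_le_nhds (show -c < -(c / 2) by linarith))
    rw [eventually_nhdsWithin_iff] at h1
    filter_upwards [h1, isOpen_Ioo.mem_nhds hm, mem_interior_iff_mem_nhds.1 hmA] with x hx h2 h3
    refine ⟨h2, h3, ?_⟩
    by_cases he : x = m
    · simp [he, hq0]
    · have h4 : 0 < (x - m) ^ q := hq.pow_pos (sub_ne_zero.2 he)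
      exact (div_le_iff₀ h4).1 (hx he)
  obtain ⟨ε, hε, hball⟩ := Metric.nhds_basis_closedBall.eventually_iff.1 hev
  rw [Real.closedBall_eq_Icc] at hball
  have hl := (hball (Set.left_mem_Icc.2 (by linarith))).1.1
  have hr := (hball (Set.right_mem_Icc.2 (by linarith))).1.2
  set W := Set.Icc (m - ε) (m + ε) with hW
  have hWA : W ⊆ A := fun x hx => (hball hx).2.1
  obtain ⟨δ, hδ, hfar⟩ := exists_gap (p := p) (β := β) (h := h) (M := H p β h m)
    (((isCompact_Icc (a := (-1 : ℝ)) (b := 1)).inter_right (isClosed_closure (s := A))).diff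
      (isOpen_Ioo (a := m - ε) (b := m + ε)))
    fun x hx => hA x ⟨hx.1, fun he => hx.2 (by rw [he]; constructor <;> linarith)⟩
  have h1 := tendsto_gibbsSum_window ha ha1 haq hq hc hε hl hr hT (fun x hx => (hball hx).2.2) hB hf
  have h2 := tendsto_gibbsSum_far (p := p) (β := β) (h := h) (m := m)
    (φ := fun N => (A \ W).indicator (f N)) (B := B) ha1 hδ
    (fun N x => by
      by_cases hx : x ∈ A \ W
      · rw [Set.indicator_of_mem hx]; exact hB N x
      · rw [Set.indicator_of_notMem hx, abs_zero]; exact hB0)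
    (fun N x hx h0 => by
      have hxA := Set.mem_of_indicator_ne_zero h0
      exact hfar x ⟨⟨hx, subset_closure hxA.1⟩, fun hI => hxA.2 (Set.Ioo_subset_Icc_self hI)⟩)
  have h3 := h1.add h2
  rw [add_zero, ← hW] at h3
  refine h3.congr fun N => ?_
  rw [← mul_add, ← gibbsSum_add]
  congr 2
  funext x
  by_cases hxW : x ∈ W
  · simp [hxW, hWA hxW]
  · by_cases hxA : x ∈ A <;> simp [hxW, hxA]

/-! ### Weak convergence -/

theorem exists_probabilityMeasure_coe_eq {μ : Measure ℝ} (hμ : IsProbabilityMeasure μ) :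
    ∃ L : ProbabilityMeasure ℝ, (L : Measure ℝ) = μ :=
  ⟨⟨μ, hμ⟩, rfl⟩

theorem tendstoInDistribution_of_forall_integral {Ω : ℕ → Type*} [∀ N, MeasurableSpace (Ω N)]
    {X : (N : ℕ) → Ω N → ℝ} {μ : (N : ℕ) → Measure (Ω N)} [∀ N, IsProbabilityMeasure (μ N)]
    {L : Measure ℝ} [IsProbabilityMeasure L] (hX : ∀ N, Measurable (X N))
    (hlim : ∀ g : BoundedContinuousFunction ℝ ℝ,
      Tendsto (fun N => ∫ x, g (X N x) ∂(μ N)) atTop (𝓝 (∫ y, g y ∂L))) :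
    TendstoInDistribution X atTop (id : ℝ → ℝ) μ L where
  forall_aemeasurable N := (hX N).aemeasurable
  tendsto := by
    refine ProbabilityMeasure.tendsto_iff_forall_integral_tendsto.2 fun g => ?_
    change Tendsto (fun N => ∫ y, g y ∂((μ N).map (X N))) atTop (𝓝 (∫ y, g y ∂(L.map id)))
    rw [Measure.map_id]
    refine (hlim g).congr fun N => ?_
    rw [integral_map (hX N).aemeasurable g.continuous.aestronglyMeasurable]

/-- Convergence of the conditional expectations of the rescaled magnetization; the last conjunct
says that the conditioning event has positive probability for large `N`. -/
theorem tendsto_integral_cond {p : ℕ} (hp : p ≠ 0) {β h m a c : ℝ} {q : ℕ} {A : Set ℝ}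
    (ha : 0 < a) (ha1 : a ≤ 1 / 2) (haq : a * q = 1) (hq : Even q) (hc : 0 < c)
    (hm : m ∈ Set.Ioo (-1 : ℝ) 1) (hmA : m ∈ interior A)
    (hA : ∀ x, x ∈ (Set.Icc (-1 : ℝ) 1 ∩ closure A) \ {m} → H p β h x < H p β h m)
    (hT : Tendsto (fun x => (H p β h x - H p β h m) / (x - m) ^ q) (𝓝[≠] m) (𝓝 (-c)))
    (hI : 0 < ∫ t : ℝ, Real.exp (-c * t ^ q)) :
    (∀ g : BoundedContinuousFunction ℝ ℝ,
      Tendsto (fun N : ℕ => ∫ x, g ((N : ℝ) ^ a * (sampleMean x - m))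
          ∂(ProbabilityTheory.cond (model p β h N) {x | sampleMean x ∈ A})) atTop
        (𝓝 ((∫ t, g t * Real.exp (-c * t ^ q)) / ∫ t : ℝ, Real.exp (-c * t ^ q)))) ∧
    ∀ᶠ N : ℕ in atTop, model p β h N {x | sampleMean x ∈ A} ≠ 0 := by
  have hκ : 0 < √(2 / (1 - m ^ 2)) / √Real.pi / 2 := by
    have := one_sub_sq_pos hm
    have := Real.pi_pos
    positivity
  have h1 := tendsto_gibbsSum ha ha1 haq hq hc hm hmA hA hT (f := fun _ _ => 1) (F := fun _ => 1)
    (B := 1) (fun _ _ => by simp) (fun _ _ _ => tendsto_const_nhds)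
  simp only [one_mul] at h1
  have hpos := mul_pos hκ hI
  refine ⟨fun g => ?_, ?_⟩
  · have h2 := tendsto_gibbsSum ha ha1 haq hq hc hm hmA hA hT
      (f := fun N x => g ((N : ℝ) ^ a * (x - m))) (F := g) (B := ‖g‖)
      (fun N x => g.norm_coe_le_norm _) (fun t u hu => (g.continuous.tendsto t).comp hu)
    have h3 := h2.div h1 hpos.ne'
    rw [mul_div_mul_left _ _ hκ.ne'] at h3
    refine h3.congr' ?_
    filter_upwards [eventually_ne_atTop 0] with N hN
    rw [integral_cond_model hp β h m hN A fun y => g ((N : ℝ) ^ a * (y - m)), Pi.div_apply,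
      mul_div_mul_left]
    positivity
  · filter_upwards [h1.eventually (eventually_gt_nhds hpos), eventually_ne_atTop 0] with N h2 hN
    exact model_ne_zero hp β h m hN fun h0 => by rw [h0, mul_zero] at h2; exact lt_irrefl _ h2

/-- If there is a single maximizer, no conditioning is needed. -/
theorem tendstoInDistribution_of_unique {p : ℕ} (hp : p ≠ 0) {β h m a c : ℝ} {q : ℕ}
    (ha : 0 < a) (ha1 : a ≤ 1 / 2) (haq : a * q = 1) (hq : Even q) (hc : 0 < c)
    (hmax : maximizers p β h = {m})
    (hT : Tendsto (fun x => (H p β h x - H p β h m) / (x - m) ^ q) (𝓝[≠] m) (𝓝 (-c)))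
    (hI : 0 < ∫ t : ℝ, Real.exp (-c * t ^ q)) {L : Measure ℝ} [IsProbabilityMeasure L]
    (hL : ∀ g : BoundedContinuousFunction ℝ ℝ, ∫ y, g y ∂L =
      (∫ t, g t * Real.exp (-c * t ^ q)) / ∫ t : ℝ, Real.exp (-c * t ^ q)) :
    TendstoInDistribution
      (fun (N : ℕ) (x : Config N) => (N : ℝ) ^ a * (sampleMean x - m))
      atTop (id : ℝ → ℝ) (fun N => model p β h N) L := by
  have hmm : m ∈ maximizers p β h := by rw [hmax]; rfl
  have hA : ∀ x, x ∈ (Set.Icc (-1 : ℝ) 1 ∩ closure Set.univ) \ {m} → H p β h x < H p β h m := by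
    rintro x ⟨⟨hx, -⟩, hne⟩
    refine (hmm.2 x hx).lt_of_ne fun he => hne ?_
    rw [← hmax]
    exact ⟨hx, fun y hy => he ▸ hmm.2 y hy⟩
  have h1 := (tendsto_integral_cond hp ha ha1 haq hq hc (maximizers_subset_Ioo p β h hmm)
    (by simp) hA hT hI).1
  refine tendstoInDistribution_of_forall_integral (fun N => measurable_of_config _) fun g => ?_
  rw [hL g]
  refine (h1 g).congr fun N => ?_
  simp only [Set.mem_univ]
  rw [show {x : Config N | True} = Set.univ from rfl, cond_univ]

/-! ### The limit laws -/

theorem tendsto_quadratic {p : ℕ} {β h m : ℝ} (hm : m ∈ maximizers p β h) :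
    Tendsto (fun x => (H p β h x - H p β h m) / (x - m) ^ 2) (𝓝[≠] m)
      (𝓝 (-(-iteratedDeriv 2 (H p β h) m / 2))) := by
  have hI := maximizers_subset_Ioo p β h hm
  have hT := tendsto_div_pow_of_iteratedDeriv_eq_zero (n := 2) two_ne_zero hI
    (contDiffOn_H p β h 2) (by
      intro k hk
      obtain rfl : k = 1 := by simp at hk; omega
      rw [iteratedDeriv_one_H p β h hI, derivH1_eq_zero hm hI])
  convert hT using 2
  simp
  ring

theorem tendsto_quartic {p : ℕ} (hp : 3 ≤ p) {β h m : ℝ} (hm : m ∈ maximizers p β h)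
    (h2 : derivH2 p β m = 0) :
    Tendsto (fun x => (H p β h x - H p β h m) / (x - m) ^ 4) (𝓝[≠] m)
      (𝓝 (-(-iteratedDeriv 4 (H p β h) m / 24))) := by
  have hI := maximizers_subset_Ioo p β h hm
  have hT := tendsto_div_pow_of_iteratedDeriv_eq_zero (n := 4) four_ne_zero hI
    (contDiffOn_H p β h 4) (by
      intro k hk
      obtain rfl | rfl | rfl : k = 1 ∨ k = 2 ∨ k = 3 := by simp at hk; omega
      · rw [iteratedDeriv_one_H p β h hI, derivH1_eq_zero hm hI]
      · rw [iteratedDeriv_two_H p hp β h hI, h2]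
      · rw [iteratedDeriv_three_H p hp β h hI, derivH3_eq_zero hp hm h2])
  convert hT using 2
  norm_num [Nat.factorial]
  ring

theorem integral_exp_quadratic_pos {c : ℝ} (hc : 0 < c) :
    0 < ∫ t : ℝ, Real.exp (-c * t ^ 2) := by
  rw [integral_gaussian]
  have := Real.pi_pos
  positivity

theorem integral_gaussianLimit {p : ℕ} {β h m : ℝ} (h2 : iteratedDeriv 2 (H p β h) m < 0)
    (g : ℝ → ℝ) :
    ∫ y, g y ∂(gaussianLimit p β h m : Measure ℝ) =
      (∫ t, g t * Real.exp (-(-iteratedDeriv 2 (H p β h) m / 2) * t ^ 2))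
        / ∫ t : ℝ, Real.exp (-(-iteratedDeriv 2 (H p β h) m / 2) * t ^ 2) := by
  set d := iteratedDeriv 2 (H p β h) m with hd
  have hv : 0 < -1 / d := div_pos_of_neg_of_neg (by norm_num) h2
  have hv' : Real.toNNReal (-1 / d) ≠ 0 := by simpa using hv
  rw [integral_gaussian, gaussianLimit, ProbabilityMeasure.coe_mk,
    integral_gaussianReal_eq_integral_smul hv', ← integral_div]
  congr 1
  funext t
  rw [gaussianPDFReal, smul_eq_mul, Real.coe_toNNReal _ hv.le]
  have e1 : 2 * Real.pi * (-1 / d) = Real.pi / (-d / 2) := by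
    have := h2.ne
    field_simp
  have e2 : -(t - 0) ^ 2 / (2 * (-1 / d)) = -(-d / 2) * t ^ 2 := by
    have := h2.ne
    field_simp
    ring
  rw [e1, e2]
  ring

theorem integral_exp_quartic {c : ℝ} (hc : 0 < c) :
    ∫ t : ℝ, Real.exp (-c * t ^ 4) = c ^ (-(1 / 4) : ℝ) * Real.Gamma (1 / 4) / 2 := by
  have h1 := integral_exp_neg_mul_rpow (p := 4) (by norm_num) hc
  have h2 := integral_comp_abs (f := fun t : ℝ => Real.exp (-c * t ^ (4 : ℝ)))
  have h3 : ∀ t : ℝ, |t| ^ (4 : ℝ) = t ^ 4 := by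
    intro t
    rw [show (4 : ℝ) = ((4 : ℕ) : ℝ) by norm_num, Real.rpow_natCast]
    exact Even.pow_abs (by decide) t
  simp only [h3] at h2
  rw [h2, h1, Real.Gamma_add_one (by norm_num)]
  norm_num
  ring

theorem integrable_exp_quartic {c : ℝ} (hc : 0 < c) :
    Integrable fun t : ℝ => Real.exp (-c * t ^ 4) := by
  have hpos : 0 < ∫ t : ℝ, Real.exp (-c * t ^ 4) := by
    rw [integral_exp_quartic hc]
    have := Real.Gamma_pos_of_pos (show (0 : ℝ) < 1 / 4 by norm_num)
    positivity
  exact not_imp_comm.1 integral_undef hpos.ne'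

theorem quarticDensity_eq {p : ℕ} {β h m : ℝ} (h4 : iteratedDeriv 4 (H p β h) m < 0) (x : ℝ) :
    quarticDensity p β h m x = Real.exp (-(-iteratedDeriv 4 (H p β h) m / 24) * x ^ 4)
      / ∫ t : ℝ, Real.exp (-(-iteratedDeriv 4 (H p β h) m / 24) * t ^ 4) := by
  set d := iteratedDeriv 4 (H p β h) m with hd
  have hc : 0 < -d / 24 := by linarith
  have hΓ := Real.Gamma_pos_of_pos (show (0 : ℝ) < 1 / 4 by norm_num)
  rw [integral_exp_quartic hc, quarticDensity, ← hd, Real.rpow_neg hc.le]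
  have h1 : 0 < (-d / 24) ^ (1 / 4 : ℝ) := by positivity
  have h2 : -(-d / 24) * x ^ 4 = d / 24 * x ^ 4 := by ring
  rw [h2]
  field_simp

theorem quarticDensity_nonneg {p : ℕ} {β h m : ℝ} (h4 : iteratedDeriv 4 (H p β h) m < 0) (x : ℝ) :
    0 ≤ quarticDensity p β h m x := by
  rw [quarticDensity_eq h4]
  exact div_nonneg (Real.exp_pos _).le (integral_nonneg fun _ => (Real.exp_pos _).le)

theorem isProbabilityMeasure_quartic {p : ℕ} {β h m : ℝ}
    (h4 : iteratedDeriv 4 (H p β h) m < 0) :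
    IsProbabilityMeasure (volume.withDensity
      (fun x => ENNReal.ofReal (quarticDensity p β h m x))) := by
  have hc : 0 < -iteratedDeriv 4 (H p β h) m / 24 := by linarith
  have hint := integrable_exp_quartic hc
  have hpos := integral_exp_pos hint
  constructor
  rw [withDensity_apply _ MeasurableSet.univ, Measure.restrict_univ,
    ← ofReal_integral_eq_lintegral_ofReal _ (ae_of_all _ (quarticDensity_nonneg h4))]
  · simp_rw [quarticDensity_eq h4]
    rw [integral_div, div_self hpos.ne', ENNReal.ofReal_one]
  · exact (hint.div_const _).congr (ae_of_all _ fun x => (quarticDensity_eq h4 x).symm)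

theorem integral_quartic {p : ℕ} {β h m : ℝ} (h4 : iteratedDeriv 4 (H p β h) m < 0) (g : ℝ → ℝ) :
    ∫ y, g y ∂(volume.withDensity (fun x => ENNReal.ofReal (quarticDensity p β h m x))) =
      (∫ t, g t * Real.exp (-(-iteratedDeriv 4 (H p β h) m / 24) * t ^ 4))
        / ∫ t : ℝ, Real.exp (-(-iteratedDeriv 4 (H p β h) m / 24) * t ^ 4) := by
  have hmeas : Measurable fun x => ENNReal.ofReal (quarticDensity p β h m x) := by
    unfold quarticDensity
    fun_prop
  rw [integral_withDensity_eq_integral_toReal_smul hmeas (ae_of_all _ fun _ => ENNReal.ofReal_lt_top),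
    ← integral_div]
  congr 1
  funext t
  rw [ENNReal.toReal_ofReal (quarticDensity_nonneg h4 t), quarticDensity_eq h4, smul_eq_mul]
  ring

/-! ### Several maximizers -/

/-- The Laplace constant of a nondegenerate maximizer is its mixture weight. -/
theorem laplace_const_eq_mixWeight {p : ℕ} {β h m : ℝ} (hm : m ∈ Set.Ioo (-1 : ℝ) 1)
    (h2 : iteratedDeriv 2 (H p β h) m < 0) :
    √(2 / (1 - m ^ 2)) / √Real.pi / 2 *
      ∫ t : ℝ, Real.exp (-(-iteratedDeriv 2 (H p β h) m / 2) * t ^ 2) = mixWeight p β h m := by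
  set d := iteratedDeriv 2 (H p β h) m with hd
  have h1 := one_sub_sq_pos hm
  have hπ := Real.pi_pos
  have hpos : 0 < (m ^ 2 - 1) * d := mul_pos_of_neg_of_neg (by linarith) h2
  rw [integral_gaussian, mixWeight, ← hd, Real.rpow_neg hpos.le, ← Real.sqrt_eq_rpow,
    ← Real.sqrt_inv]
  have e2 : √(4 : ℝ) = 2 := by
    rw [show (4 : ℝ) = 2 ^ 2 by norm_num]; exact Real.sqrt_sq zero_le_two
  rw [← e2, ← Real.sqrt_div' _ hπ.le, ← Real.sqrt_div' _ (by norm_num : (0 : ℝ) ≤ 4),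
    ← Real.sqrt_mul (by positivity)]
  congr 1
  have h3 : (m ^ 2 - 1) ≠ 0 := by linarith
  have h4 := h2.ne
  have h5 := h1.ne'
  rw [show m ^ 2 - 1 = -(1 - m ^ 2) by ring]
  field_simp
  norm_num

theorem mixWeight_pos {p : ℕ} {β h m : ℝ} (hm : m ∈ Set.Ioo (-1 : ℝ) 1)
    (h2 : iteratedDeriv 2 (H p β h) m < 0) : 0 < mixWeight p β h m :=
  Real.rpow_pos_of_pos
    (mul_pos_of_neg_of_neg (by linarith [one_sub_sq_pos hm]) h2) _

theorem gibbsSum_sum {ι : Type*} (s : Finset ι) (p : ℕ) (β h m : ℝ) (N : ℕ) (φ : ι → ℝ → ℝ) :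
    gibbsSum p β h m N (fun x => ∑ i ∈ s, φ i x) = ∑ i ∈ s, gibbsSum p β h m N (φ i) := by
  simp only [gibbsSum, Finset.mul_sum]
  exact Finset.sum_comm

/-- With several nondegenerate maximizers, each contributes its mixture weight times the value of
the test function. -/
theorem tendsto_gibbsSum_mixture {p : ℕ} {β h M : ℝ} {K : ℕ} {m : Fin K → ℝ}
    (hinj : Function.Injective m) (hrange : Set.range m = maximizers p β h)
    (h2 : ∀ k, iteratedDeriv 2 (H p β h) (m k) < 0) (hM : M ∈ maximizers p β h)
    (g : BoundedContinuousFunction ℝ ℝ) :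
    Tendsto (fun N : ℕ => gibbsSum p β h M N g) atTop
      (𝓝 (∑ k, mixWeight p β h (m k) * g (m k))) := by
  have hmem k : m k ∈ maximizers p β h := hrange ▸ Set.mem_range_self k
  have hHM k : H p β h (m k) = H p β h M := le_antisymm (hM.2 _ (hmem k).1) ((hmem k).2 _ hM.1)
  have hlt : ∀ x ∈ Set.Icc (-1 : ℝ) 1, x ∉ Set.range m → H p β h x < H p β h M := by
    intro x hx hxm
    refine (hM.2 x hx).lt_of_ne fun he => hxm ?_
    rw [hrange]
    exact ⟨hx, fun y hy => he ▸ hM.2 y hy⟩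
  obtain ⟨U, hU, hdisj⟩ := (Set.finite_range m).t2_separation
  have hd : ∀ i j, i ≠ j → Disjoint (U (m i)) (U (m j)) := fun i j hij =>
    hdisj (Set.mem_range_self i) (Set.mem_range_self j) (hinj.ne hij)
  have hone : ∀ k, Tendsto (fun N : ℕ => gibbsSum p β h M N ((U (m k)).indicator g)) atTop
      (𝓝 (mixWeight p β h (m k) * g (m k))) := by
    intro k
    have hI := maximizers_subset_Ioo p β h (hmem k)
    have h1 := tendsto_gibbsSum (p := p) (β := β) (h := h) (a := 1 / 2) (q := 2) (A := U (m k))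
      (by norm_num) le_rfl (by norm_num) even_two (by linarith [h2 k]) hI
      (by rw [(hU _).2.interior_eq]; exact (hU _).1) (by
        rintro x ⟨⟨hx, hxU⟩, hne⟩
        rw [hHM k]
        refine hlt x hx ?_
        rintro ⟨j, rfl⟩
        have hjk : j ≠ k := fun he => hne (by rw [he]; rfl)
        exact Set.disjoint_left.1 ((hd j k hjk).closure_right (hU _).2) (hU _).1 hxU)
      (tendsto_quadratic (hmem k)) (f := fun _ => g) (F := fun _ => g (m k)) (B := ‖g‖)
      (fun _ x => g.norm_coe_le_norm x) (fun _ _ hu => (g.continuous.tendsto _).comp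
        (tendsto_of_tendsto_rescaled (by norm_num) hu))
    rw [integral_const_mul, mul_left_comm, laplace_const_eq_mixWeight hI (h2 k), mul_comm] at h1
    refine h1.congr fun N => ?_
    rw [sub_self, Real.rpow_zero, one_mul]
    simp only [gibbsSum, hHM k]
  set V : Set ℝ := ⋃ k, U (m k) with hV
  have hVo : IsOpen V := isOpen_iUnion fun k => (hU _).2
  obtain ⟨δ, hδ, hgap⟩ := exists_gap (p := p) (β := β) (h := h) (M := H p β h M)
    ((isCompact_Icc (a := (-1 : ℝ)) (b := 1)).diff hVo) (by
      rintro x ⟨hx, hxV⟩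
      refine hlt x hx ?_
      rintro ⟨k, rfl⟩
      exact hxV (Set.mem_iUnion.2 ⟨k, (hU _).1⟩))
  have hfar := tendsto_gibbsSum_far (p := p) (β := β) (h := h) (m := M) (a := 1 / 2)
    (φ := fun _ => Vᶜ.indicator g) (B := ‖g‖) le_rfl hδ
    (fun N x => by
      by_cases hx : x ∈ Vᶜ
      · rw [Set.indicator_of_mem hx]; exact g.norm_coe_le_norm x
      · rw [Set.indicator_of_notMem hx, abs_zero]; exact norm_nonneg g)
    (fun N x hx h0 => hgap x ⟨hx, Set.mem_of_indicator_ne_zero h0⟩)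
  have hsum := (tendsto_finsetSum Finset.univ fun k _ => hone k).add hfar
  rw [add_zero] at hsum
  refine hsum.congr fun N => ?_
  rw [sub_self, Real.rpow_zero, one_mul, ← gibbsSum_sum, ← gibbsSum_add]
  congr 1
  funext x
  rw [Pi.add_apply]
  by_cases hx : x ∈ V
  · obtain ⟨k, hk⟩ := Set.mem_iUnion.1 hx
    rw [Set.indicator_of_notMem (not_not.2 hx), add_zero, Finset.sum_eq_single k,
      Set.indicator_of_mem hk]
    · intro j _ hj
      exact Set.indicator_of_notMem (fun hxj => Set.disjoint_left.1 (hd j k hj) hxj hk) _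
    · simp
  · rw [Set.indicator_of_mem (show x ∈ Vᶜ from hx), Finset.sum_eq_zero, zero_add]
    intro k _
    exact Set.indicator_of_notMem (fun hxk => hx (Set.mem_iUnion.2 ⟨k, hxk⟩)) _

theorem exists_mixture_limit {p : ℕ} (hp : 3 ≤ p) {β h : ℝ} {K : ℕ} (hK : K ≠ 0) {m : Fin K → ℝ}
    (hinj : Function.Injective m) (hrange : Set.range m = maximizers p β h)
    (h2 : ∀ k, iteratedDeriv 2 (H p β h) (m k) < 0) :
    ∃ μ : ProbabilityMeasure ℝ,
      (μ : Measure ℝ) = ∑ k, ENNReal.ofReal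
        (mixWeight p β h (m k) / ∑ i, mixWeight p β h (m i)) • Measure.dirac (m k) ∧
      TendstoInDistribution (fun (N : ℕ) (x : Config N) => sampleMean x)
        atTop (id : ℝ → ℝ) (fun N => model p β h N) (μ : Measure ℝ) := by
  have hmem k : m k ∈ maximizers p β h := hrange ▸ Set.mem_range_self k
  have hw k : 0 < mixWeight p β h (m k) :=
    mixWeight_pos (maximizers_subset_Ioo p β h (hmem k)) (h2 k)
  have : NeZero K := ⟨hK⟩
  have hS : 0 < ∑ i, mixWeight p β h (m i) :=
    Finset.sum_pos (fun i _ => hw i) ⟨0, Finset.mem_univ _⟩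
  have hprob : IsProbabilityMeasure (∑ k, ENNReal.ofReal
      (mixWeight p β h (m k) / ∑ i, mixWeight p β h (m i)) • Measure.dirac (m k)) := by
    constructor
    simp only [Measure.coe_finsetSum, Finset.sum_apply, Measure.smul_apply, measure_univ,
      smul_eq_mul, mul_one]
    rw [← ENNReal.ofReal_sum_of_nonneg fun k _ => (div_pos (hw k) hS).le, ← Finset.sum_div,
      div_self hS.ne', ENNReal.ofReal_one]
  obtain ⟨L, hL⟩ := exists_probabilityMeasure_coe_eq hprob
  refine ⟨L, hL, ?_⟩
  refine tendstoInDistribution_of_forall_integral (fun N => measurable_of_config _) fun g => ?_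
  have h1 := tendsto_gibbsSum_mixture hinj hrange h2 (hmem 0) (BoundedContinuousFunction.const ℝ 1)
  have h3 := (tendsto_gibbsSum_mixture hinj hrange h2 (hmem 0) g).div h1 (by simpa using hS.ne')
  have e : ∫ y, g y ∂(L : Measure ℝ) =
      (∑ k, mixWeight p β h (m k) * g (m k)) /
        ∑ k, mixWeight p β h (m k) * BoundedContinuousFunction.const ℝ (1 : ℝ) (m k) := by
    rw [hL, integral_finsetSum_measure]
    · simp only [integral_smul_measure, integral_dirac, BoundedContinuousFunction.const_apply,
        mul_one, Finset.sum_div, smul_eq_mul]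
      refine Finset.sum_congr rfl fun k _ => ?_
      rw [ENNReal.toReal_ofReal (div_pos (hw k) hS).le]
      ring
    · intro k _
      exact (g.integrable _).smul_measure ENNReal.ofReal_ne_top
  rw [e]
  refine h3.congr' ?_
  filter_upwards [eventually_ne_atTop 0] with N hN
  exact (integral_model (by omega) β h (m 0) hN g).symm

/-- The Gaussian limit of the rescaled magnetization, conditioned to be close to one of the
maximizers. -/
theorem exists_conditional_limit {p : ℕ} (hp : 3 ≤ p) {β h m : ℝ} (hm : m ∈ maximizers p β h)
    (h2 : iteratedDeriv 2 (H p β h) m < 0) {A : Set ℝ} (hmA : m ∈ interior A)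
    (hA : ∀ x ∈ closure A \ {m}, H p β h x < H p β h m) :
    ∃ ν : ℕ → ProbabilityMeasure ℝ,
      (∀ᶠ N : ℕ in atTop, (ν N : Measure ℝ) =
        Measure.map (fun x : Config N => (N : ℝ) ^ (1 / 2 : ℝ) * (sampleMean x - m))
          (ProbabilityTheory.cond (model p β h N) {x | sampleMean x ∈ A})) ∧
      Tendsto ν atTop (𝓝 (gaussianLimit p β h m)) := by
  have hc : 0 < -iteratedDeriv 2 (H p β h) m / 2 := by linarith
  obtain ⟨h1, hpos⟩ := tendsto_integral_cond (p := p) (by omega) (a := 1 / 2) (q := 2)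
    (by norm_num) le_rfl (by norm_num) even_two hc (maximizers_subset_Ioo p β h hm) hmA
    (fun x hx => hA x ⟨hx.1.2, hx.2⟩) (tendsto_quadratic hm) (integral_exp_quadratic_pos hc)
  have hex : ∀ N : ℕ, ∃ ν : ProbabilityMeasure ℝ, model p β h N {x | sampleMean x ∈ A} ≠ 0 →
      (ν : Measure ℝ) =
        Measure.map (fun x : Config N => (N : ℝ) ^ (1 / 2 : ℝ) * (sampleMean x - m))
          (ProbabilityTheory.cond (model p β h N) {x | sampleMean x ∈ A}) := by
    intro N
    by_cases hN : model p β h N {x | sampleMean x ∈ A} = 0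
    · -- for such `N` any probability measure will do
      exact ⟨gaussianLimit p β h m, fun h0 => absurd hN h0⟩
    · have := cond_isProbabilityMeasure hN
      exact ⟨⟨_, Measure.isProbabilityMeasure_map (measurable_of_config _).aemeasurable⟩,
        fun _ => rfl⟩
  choose ν hν using hex
  refine ⟨ν, ?_, ?_⟩
  · filter_upwards [hpos] with N hN using hν N hN
  · rw [ProbabilityMeasure.tendsto_iff_forall_integral_tendsto]
    intro g
    rw [integral_gaussianLimit h2]
    refine (h1 g).congr' ?_
    filter_upwards [hpos] with N hN
    rw [hν N hN, integral_map (measurable_of_config _).aemeasurable g.continuous.aestronglyMeasurable]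

end TensorCurieWeiss

theorem theorem2p1 (p : ℕ) (hp : 3 ≤ p) (β h : ℝ) (hβ : 0 ≤ β) :
    -- regular points
    (TensorCurieWeiss.IsRegular p β h →
      ∀ m : ℝ, TensorCurieWeiss.maximizers p β h = {m} →
        TendstoInDistribution
          (fun (N : ℕ) (x : TensorCurieWeiss.Config N) =>
            (N : ℝ) ^ (1 / 2 : ℝ) * (TensorCurieWeiss.sampleMean x - m))
          atTop (id : ℝ → ℝ)
          (fun N => TensorCurieWeiss.model p β h N)
          (TensorCurieWeiss.gaussianLimit p β h m : Measure ℝ)) ∧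
    -- critical points
    (TensorCurieWeiss.IsCritical p β h →
      ∃ (K : ℕ) (m : Fin K → ℝ), (K = 2 ∨ K = 3) ∧ StrictMono m ∧
        Set.range m = TensorCurieWeiss.maximizers p β h ∧
        (∀ k, m k ∈ Set.Ioo (-1 : ℝ) 1) ∧
        (∀ k, iteratedDeriv 2 (TensorCurieWeiss.H p β h) (m k) < 0) ∧
        (∃ μ : ProbabilityMeasure ℝ,
          (μ : Measure ℝ) = ∑ k, ENNReal.ofReal
            (TensorCurieWeiss.mixWeight p β h (m k) /
              ∑ i, TensorCurieWeiss.mixWeight p β h (m i)) • Measure.dirac (m k) ∧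
          TendstoInDistribution
            (fun (N : ℕ) (x : TensorCurieWeiss.Config N) => TensorCurieWeiss.sampleMean x)
            atTop (id : ℝ → ℝ)
            (fun N => TensorCurieWeiss.model p β h N) (μ : Measure ℝ)) ∧
        -- conditional law of the rescaled mean given that the mean lies in the interval `A`
        (∀ (k : Fin K) (A : Set ℝ), A ⊆ Set.Icc (-1) 1 → A.OrdConnected →
          m k ∈ interior A →
          (∀ x ∈ closure A \ {m k},
            TensorCurieWeiss.H p β h x < TensorCurieWeiss.H p β h (m k)) →
          ∃ ν : ℕ → ProbabilityMeasure ℝ,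
            (∀ᶠ N : ℕ in atTop, (ν N : Measure ℝ) =
              Measure.map
                (fun x : TensorCurieWeiss.Config N =>
                  (N : ℝ) ^ (1 / 2 : ℝ) * (TensorCurieWeiss.sampleMean x - m k))
                (ProbabilityTheory.cond (TensorCurieWeiss.model p β h N)
                  {x | TensorCurieWeiss.sampleMean x ∈ A})) ∧
            Tendsto ν atTop (𝓝 (TensorCurieWeiss.gaussianLimit p β h (m k))))) ∧
    -- special points
    (TensorCurieWeiss.IsSpecial p β h →
      ∀ m : ℝ, TensorCurieWeiss.maximizers p β h = {m} →
        iteratedDeriv 4 (TensorCurieWeiss.H p β h) m < 0 ∧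
        ∃ F : ProbabilityMeasure ℝ,
          (F : Measure ℝ) = volume.withDensity
            (fun x => ENNReal.ofReal (TensorCurieWeiss.quarticDensity p β h m x)) ∧
          TendstoInDistribution
            (fun (N : ℕ) (x : TensorCurieWeiss.Config N) =>
              (N : ℝ) ^ (1 / 4 : ℝ) * (TensorCurieWeiss.sampleMean x - m))
            atTop (id : ℝ → ℝ)
            (fun N => TensorCurieWeiss.model p β h N) (F : Measure ℝ)) := by
  refine ⟨fun hreg m hmax => ?_, fun hcr => ?_, fun hsp m hmax => ?_⟩
  · obtain ⟨m', -, hmax', h2⟩ := hreg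
    obtain rfl : m' = m := Set.singleton_injective (hmax'.symm.trans hmax)
    have hc : 0 < -iteratedDeriv 2 (TensorCurieWeiss.H p β h) m' / 2 := by linarith
    exact TensorCurieWeiss.tendstoInDistribution_of_unique (by omega) (q := 2) (by norm_num) le_rfl
      (by norm_num) even_two hc hmax
      (TensorCurieWeiss.tendsto_quadratic (by rw [hmax]; rfl))
      (TensorCurieWeiss.integral_exp_quadratic_pos hc)
      fun g => TensorCurieWeiss.integral_gaussianLimit h2 g
  · obtain ⟨K, m, hK, hmono, hrange⟩ := TensorCurieWeiss.exists_enum_maximizers hp hβ hcr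
    have hmem k : m k ∈ TensorCurieWeiss.maximizers p β h := hrange ▸ Set.mem_range_self k
    have hI k := TensorCurieWeiss.maximizers_subset_Ioo p β h (hmem k)
    have h2 : ∀ k, iteratedDeriv 2 (TensorCurieWeiss.H p β h) (m k) < 0 := fun k => by
      rw [TensorCurieWeiss.iteratedDeriv_two_H p hp β h (hI k)]
      exact TensorCurieWeiss.derivH2_neg_of_isCritical hp hβ hcr (hmem k)
    exact ⟨K, m, hK, hmono, hrange, hI, h2,
      TensorCurieWeiss.exists_mixture_limit hp (by omega) hmono.injective hrange h2,
      fun k A _ _ hmA hA =>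
        TensorCurieWeiss.exists_conditional_limit hp (hmem k) (h2 k) hmA hA⟩
  · obtain ⟨m', hI, hmax', h2⟩ := hsp
    obtain rfl : m' = m := Set.singleton_injective (hmax'.symm.trans hmax)
    have hmem : m' ∈ TensorCurieWeiss.maximizers p β h := by rw [hmax]; rfl
    rw [TensorCurieWeiss.iteratedDeriv_two_H p hp β h hI] at h2
    have h4 : iteratedDeriv 4 (TensorCurieWeiss.H p β h) m' < 0 := by
      rw [TensorCurieWeiss.iteratedDeriv_four_H p hp β h hI]
      exact TensorCurieWeiss.derivH4_neg hp hI h2 (TensorCurieWeiss.derivH3_eq_zero hp hmem h2)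
    have hc : 0 < -iteratedDeriv 4 (TensorCurieWeiss.H p β h) m' / 24 := by linarith
    have hprob := TensorCurieWeiss.isProbabilityMeasure_quartic h4
    obtain ⟨F, hF⟩ := TensorCurieWeiss.exists_probabilityMeasure_coe_eq hprob
    exact ⟨h4, F, hF, TensorCurieWeiss.tendstoInDistribution_of_unique (by omega) (q := 4)
      (by norm_num) (by norm_num) (by norm_num) (by decide) hc hmax
      (TensorCurieWeiss.tendsto_quartic hp hmem h2)
      (integral_exp_pos (TensorCurieWeiss.integrable_exp_quartic hc))
      fun g => hF ▸ TensorCurieWeiss.integral_quartic h4 g⟩
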